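/- Let $n\ge 1$, let $M$ be a connected finite-dimensional smooth manifold (without boundary) and let $\omega\in\Omega^{n+1}(M)$ be closed, i.e. $(M,\omega)$ is a connected pre-$n$-plectic manifold. Let $L_0=\{(v,\alpha)\in\mathfrak X(M)\times\Omega^{n-1}(M)\mid d\alpha=-\iota_v\omega\}$, let $L_i=\Omega^{n-1+i}(M)$ for $-n+1\le i\le -1$, and let $L(M,\omega)=\bigoplus_{i=-n+1}^{0}L_i$ be the Lie $n$-algebra of observables, whose brackets are: $l_1(\alpha)=d\alpha$ for $\alpha\in L_{i}$, $i<-1$, $l_1(\alpha)=(0,d\alpha)$ for $\alpha\in L_{-1}$, $l_1=0$ on $L_0$; $l_2((v,\alpha),(w,\beta))=([v,w],\iota_w\iota_v\omega)$ on $L_0\times L_0$; $l_k((v_1,\alpha_1),\dots,(v_k,\alpha_k))=-(-1)^{k(k+1)/2}\iota_{v_k}\cdots\iota_{v_1}\omega$ on $L_0\times\dots\times L_0$ for $k\ge 3$; and $l_k=0$ for $k\geq 2$ as soon as one argument is homogeneous of nonzero degree. Let $\mathfrak g$ be a finite-dimensional real Lie algebra and $\zeta:\mathfrak g\to\mathfrak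 X(M)$ a Lie algebra homomorphism (an infinitesimal action) which is weakly Hamiltonian, i.e. there is a linear map $j:\mathfrak g\to L_0$ whose $\mathfrak X(M)$-component is $\zeta$. For $p\in M$ put $$c_p(X_1,\dots,X_{n+1})=-(-1)^n(-1)^{n(n+1)/2}\,\omega(\zeta(X_1),\dots,\zeta(X_{n+1}))|_p .$$ Suppose that $H^k_{dR}(M)=0$ for all $1\le k\le n-1$ and that, for some point $p\in M$, the class $[c_p]\in H^{n+1}(\mathfrak g)$ in Chevalley–Eilenberg cohomology with trivial coefficients $\mathbb R$ vanishes, i.e. $c_p=\delta b$ for some alternating $n$-linear form $b$ on $\mathfrak g$, where $(\delta b)(X_1,\dots,X_{n+1})=\sum_{i<j}(-1)^{i+j}b([X_i,X_j],X_1,\dots,\hat X_i,\dots,\hat X_j,\dots,X_{n+1})$. Then there exists a homotopy co-moment map for $\zeta$: an $L_\infty$-morphism $F=\{f_k\}_{k\ge1}:\mathfrak g\to L(M,\omega)$ such that the $\mathfrak X(M)$-component of $f_1(X)\in L_0$ is $\zeta(X)$ for every $X\in\mathfrak g$. Here $\mathfrak g$ is regarded as an $L_\infty$-algebra concentrated in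 degree $0$ with $l_2=[\cdot,\cdot]$ as its only nonzero bracket, and an $L_\infty$-morphism $(L,l_i)\to(L',l'_i)$ is a family of graded skew-symmetric multilinear maps $f_k:L^{\times k}\to L'$ of degree $1-k$ such that, for all $N\ge1$ and homogeneous $x_1,\dots,x_N$, $$\sum_{i+j=N+1}\ \sum_{\sigma\in ush(i,N-i)}(-1)^{i(j+1)}\,\mathrm{sgn}(\sigma)\,\epsilon(\sigma;x)\,f_j\big(l_i(x_{\sigma(1)},\dots,x_{\sigma(i)}),x_{\sigma(i+1)},\dots,x_{\sigma(N)}\big)$$ $$=\sum_{p=1}^N\ \sum_{\substack{k_1\le\dots\le k_p\\ k_1+\dots+k_p=N}}\ \sum_{\sigma}(-1)^{\beta}\,\mathrm{sgn}(\sigma)\,\epsilon(\sigma;x)\,l'_p\big(f_{k_1}(x_{\sigma(1)},\dots,x_{\sigma(k_1)}),\dots,f_{k_p}(x_{\sigma(N-k_p+1)},\dots,x_{\sigma(N)})\big),$$ where $i,j,k_r\ge1$; $ush(k_1,\dots,k_p)$ is the set of permutations that are increasing on each of the consecutive blocks of lengths $k_1,\dots,k_p$; on the right, $\sigma$ runs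 over those $\sigma\in ush(k_1,\dots,k_p)$ with $\sigma(k_1+\dots+k_{r-1}+1)<\sigma(k_1+\dots+k_{r}+1)$ whenever $k_r=k_{r+1}$; $\epsilon$ is the Koszul sign; and $\beta=\frac{p(p-1)}2+\sum_{r=1}^pk_r(p-r)+\sum_{r=2}^p(k_r-1)\sum_{i=1}^{k_1+\dots+k_{r-1}}|x_{\sigma(i)}|$. -/

import Mathlib

set_option linter.unusedSectionVars false

open scoped Manifold ContDiff Bundle Topology

noncomputable section

namespace NPlectic

section Normed
variable {E : Type*} [NormedAddCommGroup E] [NormedSpace ℝ E]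

theorem contDiffAt_alt_apply {F : Type*} [NormedAddCommGroup F] [NormedSpace ℝ F]
    [FiniteDimensional ℝ E] {k : ℕ}
    {f : F → E [⋀^Fin k]→L[ℝ] ℝ} {u : Fin k → F → E} {y : F}
    (hf : ContDiffAt ℝ ∞ f y) (hu : ∀ i, ContDiffAt ℝ ∞ (u i) y) :
    ContDiffAt ℝ ∞ (fun z => f z (fun i => u i z)) y := by
  have h := ((ContinuousAlternatingMap.toContinuousMultilinearMapLI (𝕜 := ℝ) (E := E)
    (F := ℝ) (ι := Fin k)).toContinuousLinearMap).analyticAt_uncurry_of_multilinear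
      (x := (f y, fun i => u i y))
  exact (h.contDiffAt (n := ∞)).comp y (hf.prodMk (contDiffAt_pi.2 hu))

theorem contDiffAt_alt_iff {F : Type*} [NormedAddCommGroup F] [NormedSpace ℝ F]
    [FiniteDimensional ℝ E] {k : ℕ} {f : F → E [⋀^Fin k]→L[ℝ] ℝ} {y : F} :
    ContDiffAt ℝ ∞ f y ↔ ∀ v : Fin k → E, ContDiffAt ℝ ∞ (fun z => f z v) y := by
  refine ⟨fun h v => contDiffAt_alt_apply h fun i => contDiffAt_const, fun h => ?_⟩
  let b := Module.finBasis ℝ E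
  let T : (E [⋀^Fin k]→L[ℝ] ℝ) →ₗ[ℝ] ((Fin k → Fin (Module.finrank ℝ E)) → ℝ) :=
    { toFun := fun g s => g (fun i => b (s i))
      map_add' := fun _ _ => rfl
      map_smul' := fun _ _ => rfl }
  have hT : LinearMap.ker T = ⊥ := by
    rw [LinearMap.ker_eq_bot]
    intro g g' hg
    have := Module.Basis.ext_multilinear (f := g.toMultilinearMap) (g := g'.toMultilinearMap)
      (fun _ => b) (fun s => congrFun hg s)
    ext v
    exact congrArg (fun q => q v) this
  obtain ⟨S, hS⟩ := LinearMap.exists_leftInverse_of_injective T hT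
  have : f = fun z => LinearMap.toContinuousLinearMap S (T (f z)) := by
    ext1 z
    exact (LinearMap.congr_fun hS (f z)).symm
  rw [this]
  exact (ContinuousLinearMap.contDiff _).contDiffAt.comp y (contDiffAt_pi.2 fun s => h _)

theorem contDiffAt_alt_comp {F : Type*} [NormedAddCommGroup F] [NormedSpace ℝ F]
    [FiniteDimensional ℝ E] {k : ℕ}
    {f : F → E [⋀^Fin k]→L[ℝ] ℝ} {g : F → E →L[ℝ] E} {y : F}
    (hf : ContDiffAt ℝ ∞ f y) (hg : ContDiffAt ℝ ∞ g y) :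
    ContDiffAt ℝ ∞ (fun z => (f z).compContinuousLinearMap (g z)) y :=
  contDiffAt_alt_iff.2 fun v =>
    contDiffAt_alt_apply (u := fun i z => g z (v i)) hf
      fun _ => hg.clm_apply contDiffAt_const

theorem contDiffAt_extDeriv {k : ℕ} {f : E → E [⋀^Fin k]→L[ℝ] ℝ} {y : E}
    [FiniteDimensional ℝ E]
    (hf : ContDiffAt ℝ ∞ f y) : ContDiffAt ℝ ∞ (extDeriv f) y := by
  have h1 : ContDiffAt ℝ ∞ (fderiv ℝ f) y := hf.fderiv_right (m := ∞) (by simp)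
  refine contDiffAt_alt_iff.2 fun v => ?_
  have : (fun z => extDeriv f z v) =
      fun z => ∑ i : Fin (k + 1), (-1 : ℤ) ^ (i : ℕ) • fderiv ℝ f z (v i) (i.removeNth v) := by
    ext z
    exact ContinuousAlternatingMap.alternatizeUncurryFin_apply _ _
  rw [this]
  refine ContDiffAt.sum fun i _ => ?_
  have h2 : ContDiffAt ℝ ∞ (fun z => fderiv ℝ f z (v i) (i.removeNth v)) y :=
    contDiffAt_alt_iff.1 (h1.clm_apply (contDiffAt_const (c := v i))) (i.removeNth v)
  have h3 : (fun z => (-1 : ℤ) ^ (i : ℕ) • fderiv ℝ f z (v i) (i.removeNth v))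
      = fun z => (-1 : ℝ) ^ (i : ℕ) * fderiv ℝ f z (v i) (i.removeNth v) := by
    ext z; simp
  rw [h3]
  exact contDiffAt_const.mul h2


open ContinuousAlternatingMap in
theorem alternatizeUncurryFin_curryLeft_comp {q : ℕ} (A : E →L[ℝ] E [⋀^Fin (q + 1)]→L[ℝ] ℝ)
    (v : E) (B : E →L[ℝ] E [⋀^Fin q]→L[ℝ] ℝ) (hB : ∀ h, B h = (A h).curryLeft v) :
    alternatizeUncurryFin B = A v - (alternatizeUncurryFin A).curryLeft v := by
  ext u
  rw [alternatizeUncurryFin_apply, ContinuousAlternatingMap.sub_apply, curryLeft_apply_apply,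
    alternatizeUncurryFin_apply]
  have h0 : (0 : Fin (q + 2)).removeNth (Matrix.vecCons v u) = u := by
    ext i; simp [Fin.removeNth]
  have hs : ∀ i : Fin (q + 1), i.succ.removeNth (Matrix.vecCons v u)
      = Matrix.vecCons v (i.removeNth u) := by
    intro i
    ext j
    refine Fin.cases ?_ (fun j => ?_) j <;> simp [Fin.removeNth]
  rw [Fin.sum_univ_succ (n := q + 1), h0]
  simp only [hB, hs, curryLeft_apply_apply, Matrix.cons_val_zero, Matrix.cons_val_succ,
    Fin.val_zero, Fin.val_succ, pow_zero, one_smul, pow_succ]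
  simp

open ContinuousAlternatingMap in
theorem hasFDerivAt_curryLeft {q : ℕ} {ω₀ : E → E [⋀^Fin (q + 1)]→L[ℝ] ℝ} {v : E → E} {p : E}
    (hω₀ : DifferentiableAt ℝ ω₀ p) (hv : DifferentiableAt ℝ v p) :
    ∃ B : E →L[ℝ] E [⋀^Fin q]→L[ℝ] ℝ, (∀ h, B h = (fderiv ℝ ω₀ p h).curryLeft (v p)) ∧
      HasFDerivAt (fun y => (ω₀ y).curryLeft (v y)) (B + (ω₀ p).curryLeft ∘L fderiv ℝ v p) p := by
  let c := (curryLeftLI (𝕜 := ℝ) (E := E) (F := ℝ) (n := q)).toContinuousLinearMap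
  have hc0 := ContinuousLinearMap.hasFDerivAt (𝕜 := ℝ) (E := E [⋀^Fin (q + 1)]→L[ℝ] ℝ)
    (F := E →L[ℝ] E [⋀^Fin q]→L[ℝ] ℝ) (x := ω₀ p) c
  have hc1 := HasFDerivAt.comp (𝕜 := ℝ) (E := E) (F := E [⋀^Fin (q + 1)]→L[ℝ] ℝ)
    (G := E →L[ℝ] E [⋀^Fin q]→L[ℝ] ℝ) (f := ω₀) (f' := fderiv ℝ ω₀ p) p hc0 hω₀.hasFDerivAt
  have hc2 := HasFDerivAt.clm_apply (𝕜 := ℝ) (E := E) (G := E) (H := E [⋀^Fin q]→L[ℝ] ℝ)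
    hc1 hv.hasFDerivAt
  refine ⟨(c ∘L fderiv ℝ ω₀ p).flip (v p), fun h => rfl, ?_⟩
  exact hc2.congr_fderiv (add_comm _ _)

open ContinuousAlternatingMap in
/-- Cartan's identity `[[d, ι_v], ι_w] = ι_{[v, w]}` in a normed space. -/
theorem curryLeft_lieBracket {q : ℕ} {ω₀ : E → E [⋀^Fin (q + 2)]→L[ℝ] ℝ} {v w : E → E} {p : E}
    (hω₀ : DifferentiableAt ℝ ω₀ p) (hv : DifferentiableAt ℝ v p) (hw : DifferentiableAt ℝ w p) :
    (ω₀ p).curryLeft (VectorField.lieBracket ℝ v w p)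
      = extDeriv (fun y => ((ω₀ y).curryLeft (w y)).curryLeft (v y)) p
        + (extDeriv (fun y => (ω₀ y).curryLeft (w y)) p).curryLeft (v p)
        - (extDeriv (fun y => (ω₀ y).curryLeft (v y)) p).curryLeft (w p)
        - ((extDeriv ω₀ p).curryLeft (v p)).curryLeft (w p) := by
  -- the part of the Lie derivative involving the derivative of the field
  have key : ∀ {r : ℕ} (η : E → E [⋀^Fin (r + 1)]→L[ℝ] ℝ) (u : E → E),
      DifferentiableAt ℝ η p → DifferentiableAt ℝ u p →
      extDeriv (fun y => (η y).curryLeft (u y)) p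
        = fderiv ℝ η p (u p) - (extDeriv η p).curryLeft (u p)
          + alternatizeUncurryFin ((η p).curryLeft ∘L fderiv ℝ u p) := by
    intro r η u hη hu
    obtain ⟨B, hB, hD⟩ := hasFDerivAt_curryLeft hη hu
    rw [extDeriv, hD.fderiv, alternatizeUncurryFin_add,
      alternatizeUncurryFin_curryLeft_comp (fderiv ℝ η p) (u p) B hB, extDeriv]
  have swap : ∀ {r : ℕ} (η : E [⋀^Fin (r + 2)]→L[ℝ] ℝ) (a b : E),
      (η.curryLeft a).curryLeft b = - (η.curryLeft b).curryLeft a := by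
    intro r η a b
    have h := curryLeft_same η (a + b)
    ext u
    have h' := congrArg (fun g => g u) h
    have ha := congrArg (fun g => g u) (curryLeft_same η a)
    have hb := congrArg (fun g => g u) (curryLeft_same η b)
    simp only [map_add, curryLeft_add, _root_.add_apply, ContinuousAlternatingMap.add_apply] at h'
    change _ = (0 : ℝ) at ha hb
    rw [ha, hb] at h'
    rw [ContinuousAlternatingMap.neg_apply]
    change _ = (0 : ℝ) at h'
    linarith
  obtain ⟨B, hB, hD⟩ := hasFDerivAt_curryLeft hω₀ hw
  rw [key (fun y => (ω₀ y).curryLeft (w y)) v hD.differentiableAt hv, key ω₀ v hω₀ hv,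
    hD.fderiv]
  have h1 := alternatizeUncurryFin_curryLeft_comp ((ω₀ p).curryLeft ∘L fderiv ℝ v p) (w p)
    (-(((ω₀ p).curryLeft (w p)).curryLeft ∘L fderiv ℝ v p)) (fun h => by
      rw [ContinuousLinearMap.comp_apply, swap (ω₀ p)]; rfl)
  have hneg : alternatizeUncurryFin (-(((ω₀ p).curryLeft (w p)).curryLeft ∘L fderiv ℝ v p))
      = - alternatizeUncurryFin (((ω₀ p).curryLeft (w p)).curryLeft ∘L fderiv ℝ v p) := by
    ext u
    simp only [alternatizeUncurryFin_apply, ContinuousAlternatingMap.neg_apply,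
      ← Finset.sum_neg_distrib]
    refine Finset.sum_congr rfl fun i _ => ?_
    rw [← smul_neg]
    rfl
  rw [hneg, neg_eq_iff_eq_neg] at h1
  rw [h1, VectorField.lieBracket, map_sub]
  ext u
  have e1 : (B + (ω₀ p).curryLeft ∘L fderiv ℝ w p) (v p) u =
      (fderiv ℝ ω₀ p (v p)).curryLeft (w p) u + (ω₀ p).curryLeft (fderiv ℝ w p (v p)) u := by
    rw [← hB]; rfl
  simp only [ContinuousAlternatingMap.add_apply, ContinuousAlternatingMap.sub_apply,
    ContinuousAlternatingMap.neg_apply, curryLeft_apply_apply, e1,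
    ContinuousLinearMap.comp_apply]
  ring

end Normed

section Forms

variable (E : Type*) [NormedAddCommGroup E] [NormedSpace ℝ E]
  (M : Type*) [TopologicalSpace M] [ChartedSpace E M] [IsManifold 𝓘(ℝ, E) ∞ M]

/-- The fibre `Λᵏ T*ₓM`. -/
abbrev CotangentPower (k : ℕ) (x : M) : Type _ :=
  TangentSpace 𝓘(ℝ, E) x [⋀^Fin k]→L[ℝ] Bundle.Trivial M ℝ x

/-- `𝔛(M)`: smooth sections of the tangent bundle. -/
abbrev VecField : Type _ :=
  ContMDiffSection 𝓘(ℝ, E) E ∞ (TangentSpace 𝓘(ℝ, E) : M → Type _)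

/-- `Ωᵏ(M)`: smooth sections of the bundle of alternating `k`-linear forms on the tangent spaces. -/
abbrev DiffForm (k : ℕ) : Type _ :=
  ContMDiffSection 𝓘(ℝ, E) (E [⋀^Fin k]→L[ℝ] ℝ) ∞ (CotangentPower E M k)

variable {E M} {k : ℕ}

/-- The expression `(φ⁻¹)^* ω` of a form in the chart `φ` around `x₀`. -/
def chartRep (x₀ : M) (ω₀ : ∀ x : M, CotangentPower E M k x) (y : E) : E [⋀^Fin k]→L[ℝ] ℝ :=
  ContinuousAlternatingMap.compContinuousLinearMap (M := E) (N := ℝ)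
    (ω₀ ((extChartAt 𝓘(ℝ, E) x₀).symm y))
    (mfderiv 𝓘(ℝ, E) 𝓘(ℝ, E) (extChartAt 𝓘(ℝ, E) x₀).symm y)

/-- The exterior derivative at `x`, computed in the chart around `x`. -/
def extDerivField (ω₀ : ∀ x : M, CotangentPower E M k x) (x : M) : CotangentPower E M (k + 1) x :=
  ContinuousAlternatingMap.compContinuousLinearMap (M := E) (N := ℝ)
    (extDeriv (chartRep x ω₀) (extChartAt 𝓘(ℝ, E) x x))
    (mfderiv 𝓘(ℝ, E) 𝓘(ℝ, E) (extChartAt 𝓘(ℝ, E) x) x)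

/-- Contraction `ι_v ω = ω(v, ·, …, ·)`. -/
def contractField (v : ∀ x : M, TangentSpace 𝓘(ℝ, E) x)
    (ω₀ : ∀ x : M, CotangentPower E M (k + 1) x) (x : M) : CotangentPower E M k x :=
  ContinuousAlternatingMap.curryLeft (E := E) (F := ℝ) (ω₀ x) (v x)

theorem extDerivField_eq (ω₀ : ∀ x : M, CotangentPower E M k x) (x : M) :
    extDerivField ω₀ x = extDeriv (chartRep x ω₀) (extChartAt 𝓘(ℝ, E) x x) := by
  rw [extDerivField, mfderiv_extChartAt_self]
  rfl

theorem chartRep_self (ω₀ : ∀ x : M, CotangentPower E M k x) (x : M) :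
    chartRep x ω₀ (extChartAt 𝓘(ℝ, E) x x) = ω₀ x := by
  have h := mfderivWithin_range_extChartAt_symm (I := 𝓘(ℝ, E)) (x := x)
  simp only [modelWithCornersSelf_coe, Set.range_id, mfderivWithin_univ] at h
  rw [chartRep, h, extChartAt_to_inv]
  rfl

theorem contMDiffAt_form_iff {ω₀ : ∀ x : M, CotangentPower E M k x} {x₀ : M} :
    ContMDiffAt 𝓘(ℝ, E) (𝓘(ℝ, E).prod 𝓘(ℝ, E [⋀^Fin k]→L[ℝ] ℝ)) ∞
      (fun x => Bundle.TotalSpace.mk' (E [⋀^Fin k]→L[ℝ] ℝ) x (ω₀ x)) x₀ ↔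
      ContDiffAt ℝ ∞ (chartRep x₀ ω₀) (extChartAt 𝓘(ℝ, E) x₀ x₀) := by
  rw [Bundle.contMDiffAt_section]
  rw [contMDiffAt_iff_source]
  simp only [modelWithCornersSelf_coe, Set.range_id, contMDiffWithinAt_univ]
  rw [contMDiffAt_iff_contDiffAt]
  refine (fun {f g : E → E [⋀^Fin k]→L[ℝ] ℝ} {p : E} (h : f =ᶠ[𝓝 p] g) =>
    (⟨fun hf => hf.congr_of_eventuallyEq h.symm, fun hg => hg.congr_of_eventuallyEq h⟩ :
      ContDiffAt ℝ ∞ f p ↔ ContDiffAt ℝ ∞ g p)) ?_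
  filter_upwards [extChartAt_target_mem_nhds (I := 𝓘(ℝ, E)) x₀] with y hy
  have hs := TangentBundle.symmL_trivializationAt (I := 𝓘(ℝ, E)) (x₀ := x₀)
    (x := (extChartAt 𝓘(ℝ, E) x₀).symm y)
    (by rw [← extChartAt_source 𝓘(ℝ, E)]; exact (extChartAt 𝓘(ℝ, E) x₀).map_target hy)
  rw [(extChartAt 𝓘(ℝ, E) x₀).right_inv hy] at hs
  simp only [modelWithCornersSelf_coe, Set.range_id, mfderivWithin_univ] at hs
  ext u
  simp only [Function.comp_apply, FiberBundle.trivializationAt_continuousAlternatingMap_apply,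
    ContinuousAlternatingMap.inCoordinates, hs]
  simp
  rfl

/-- The expression of a vector field in the chart around `x₀`. -/
def vecRep (x₀ : M) (v : ∀ x : M, TangentSpace 𝓘(ℝ, E) x) (y : E) : E :=
  mfderiv 𝓘(ℝ, E) 𝓘(ℝ, E) (extChartAt 𝓘(ℝ, E) x₀) ((extChartAt 𝓘(ℝ, E) x₀).symm y)
    (v ((extChartAt 𝓘(ℝ, E) x₀).symm y))

theorem contDiffAt_vecRep {v : ∀ x : M, TangentSpace 𝓘(ℝ, E) x} {x₀ : M}
    (hv : ContMDiffAt 𝓘(ℝ, E) (𝓘(ℝ, E).prod 𝓘(ℝ, E)) ∞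
      (fun x => Bundle.TotalSpace.mk' E x (v x)) x₀) :
    ContDiffAt ℝ ∞ (vecRep x₀ v) (extChartAt 𝓘(ℝ, E) x₀ x₀) := by
  rw [Bundle.contMDiffAt_section, contMDiffAt_iff_source] at hv
  simp only [modelWithCornersSelf_coe, Set.range_id, contMDiffWithinAt_univ] at hv
  rw [contMDiffAt_iff_contDiffAt] at hv
  refine hv.congr_of_eventuallyEq ?_
  filter_upwards [extChartAt_target_mem_nhds (I := 𝓘(ℝ, E)) x₀] with y hy
  have hx : (extChartAt 𝓘(ℝ, E) x₀).symm y ∈ (chartAt E x₀).source := by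
    rw [← extChartAt_source 𝓘(ℝ, E)]; exact (extChartAt 𝓘(ℝ, E) x₀).map_target hy
  have hs := TangentBundle.continuousLinearMapAt_trivializationAt (I := 𝓘(ℝ, E)) (x₀ := x₀) hx
  have e := Bundle.Trivialization.coe_linearMapAt_of_mem (R := ℝ)
    (trivializationAt E (TangentSpace 𝓘(ℝ, E)) x₀) hx
  exact (DFunLike.congr_fun hs.symm (v _)).trans (congrFun e (v _))

theorem chartRep_contractField (x₀ : M) (v : ∀ x : M, TangentSpace 𝓘(ℝ, E) x)
    (ω₀ : ∀ x : M, CotangentPower E M (k + 1) x) {y : E}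
    (hy : y ∈ (extChartAt 𝓘(ℝ, E) x₀).target) :
    chartRep x₀ (contractField v ω₀) y
      = (chartRep x₀ ω₀ y).curryLeft (vecRep x₀ v y) := by
  have h := mfderivWithin_extChartAt_symm_comp_mfderiv_extChartAt (I := 𝓘(ℝ, E)) hy
  simp only [modelWithCornersSelf_coe, Set.range_id, mfderivWithin_univ] at h
  have h' := DFunLike.congr_fun h (v ((extChartAt 𝓘(ℝ, E) x₀).symm y))
  let A : E →L[ℝ] E := mfderiv 𝓘(ℝ, E) 𝓘(ℝ, E) (extChartAt 𝓘(ℝ, E) x₀).symm y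
  let η : E [⋀^Fin (k + 1)]→L[ℝ] ℝ := ω₀ ((extChartAt 𝓘(ℝ, E) x₀).symm y)
  let u : E := v ((extChartAt 𝓘(ℝ, E) x₀).symm y)
  have h'' : A (vecRep x₀ v y) = u := h'
  have h1 : (η.curryLeft u).compContinuousLinearMap A
      = (η.compContinuousLinearMap A).curryLeft (vecRep x₀ v y) := by
    rw [ContinuousAlternatingMap.curryLeft_compContinuousLinearMap, h'']
  exact h1

/-- Change of charts. -/
theorem chartRep_change (x₀ x₁ : M) (ω₀ : ∀ x : M, CotangentPower E M k x) {y : E}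
    (hy : y ∈ (extChartAt 𝓘(ℝ, E) x₀).target)
    (hy' : (extChartAt 𝓘(ℝ, E) x₀).symm y ∈ (extChartAt 𝓘(ℝ, E) x₁).source) :
    ContDiffAt ℝ ∞ (extChartAt 𝓘(ℝ, E) x₁ ∘ (extChartAt 𝓘(ℝ, E) x₀).symm) y ∧
    chartRep x₀ ω₀ y =
      (chartRep x₁ ω₀ (extChartAt 𝓘(ℝ, E) x₁ ((extChartAt 𝓘(ℝ, E) x₀).symm y))
        ).compContinuousLinearMap
        (fderiv ℝ (extChartAt 𝓘(ℝ, E) x₁ ∘ (extChartAt 𝓘(ℝ, E) x₀).symm) y) := by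
  have hτ : ContDiffAt ℝ ∞ (extChartAt 𝓘(ℝ, E) x₁ ∘ (extChartAt 𝓘(ℝ, E) x₀).symm) y := by
    rw [← contMDiffAt_iff_contDiffAt]
    refine ContMDiffAt.comp y (contMDiffAt_extChartAt' ?_) ?_
    · rwa [extChartAt_source] at hy'
    · exact (contMDiffOn_extChartAt_symm x₀).contMDiffAt
        ((isOpen_extChartAt_target x₀).mem_nhds hy)
  refine ⟨hτ, ?_⟩
  have hz : (extChartAt 𝓘(ℝ, E) x₁).symm
      (extChartAt 𝓘(ℝ, E) x₁ ((extChartAt 𝓘(ℝ, E) x₀).symm y))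
      = (extChartAt 𝓘(ℝ, E) x₀).symm y := (extChartAt 𝓘(ℝ, E) x₁).left_inv hy'
  have hD : mfderiv 𝓘(ℝ, E) 𝓘(ℝ, E) (extChartAt 𝓘(ℝ, E) x₀).symm y
      = mfderiv 𝓘(ℝ, E) 𝓘(ℝ, E) (extChartAt 𝓘(ℝ, E) x₁).symm
          (extChartAt 𝓘(ℝ, E) x₁ ((extChartAt 𝓘(ℝ, E) x₀).symm y)) ∘L
        fderiv ℝ (extChartAt 𝓘(ℝ, E) x₁ ∘ (extChartAt 𝓘(ℝ, E) x₀).symm) y := by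
    have hmem : extChartAt 𝓘(ℝ, E) x₁ ((extChartAt 𝓘(ℝ, E) x₀).symm y)
        ∈ (extChartAt 𝓘(ℝ, E) x₁).target := (extChartAt 𝓘(ℝ, E) x₁).map_source hy'
    have h1 : MDifferentiableAt 𝓘(ℝ, E) 𝓘(ℝ, E) (extChartAt 𝓘(ℝ, E) x₁).symm
        ((extChartAt 𝓘(ℝ, E) x₁ ∘ (extChartAt 𝓘(ℝ, E) x₀).symm) y) :=
      ((contMDiffOn_extChartAt_symm (n := ∞) x₁).contMDiffAt
        ((isOpen_extChartAt_target x₁).mem_nhds hmem)).mdifferentiableAt (by simp)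
    have h2 : MDifferentiableAt 𝓘(ℝ, E) 𝓘(ℝ, E)
        (extChartAt 𝓘(ℝ, E) x₁ ∘ (extChartAt 𝓘(ℝ, E) x₀).symm) y :=
      (hτ.differentiableAt (by simp)).mdifferentiableAt
    have h3 := mfderiv_comp y h1 h2
    rw [mfderiv_eq_fderiv] at h3
    refine Eq.trans ?_ h3
    refine Filter.EventuallyEq.mfderiv_eq ?_
    have hc : (extChartAt 𝓘(ℝ, E) x₀).symm ⁻¹' (extChartAt 𝓘(ℝ, E) x₁).source ∈ 𝓝 y :=
      (continuousAt_extChartAt_symm'' hy).preimage_mem_nhds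
        ((isOpen_extChartAt_source x₁).mem_nhds hy')
    filter_upwards [hc] with z hz
    exact ((extChartAt 𝓘(ℝ, E) x₁).left_inv hz).symm
  have aux : ∀ (z z' : M) (A B C : E →L[ℝ] E), z = z' → A = B ∘L C →
      (show E [⋀^Fin k]→L[ℝ] ℝ from ω₀ z').compContinuousLinearMap A
        = ((show E [⋀^Fin k]→L[ℝ] ℝ from ω₀ z).compContinuousLinearMap B
          ).compContinuousLinearMap C := by
    rintro z z' A B C rfl rfl
    rfl
  exact aux _ _ _ _ _ hz hD

theorem two_le_infty : (2 : WithTop ℕ∞) ≤ ∞ := 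
  WithTop.coe_le_coe.2 (le_top (a := (2 : ℕ∞)))

theorem three_le_infty : (3 : WithTop ℕ∞) ≤ ∞ := 
  WithTop.coe_le_coe.2 (le_top (a := (3 : ℕ∞)))

theorem minSmoothness_two_le : minSmoothness ℝ 2 ≤ ∞ := by
  rw [minSmoothness_of_isRCLikeNormedField]
  exact two_le_infty

theorem minSmoothness_three_le : minSmoothness ℝ 3 ≤ ∞ := by
  rw [minSmoothness_of_isRCLikeNormedField]
  exact three_le_infty

variable [FiniteDimensional ℝ E]

theorem contDiffAt_chartRep (ω₀ : DiffForm E M k) (x₀ : M) {y : E}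
    (hy : y ∈ (extChartAt 𝓘(ℝ, E) x₀).target) : ContDiffAt ℝ ∞ (chartRep x₀ ω₀) y := by
  set x₁ := (extChartAt 𝓘(ℝ, E) x₀).symm y with hx₁
  have h1 := contMDiffAt_form_iff.1 (ω₀.contMDiff x₁)
  have hsrc : x₁ ∈ (extChartAt 𝓘(ℝ, E) x₁).source := mem_extChartAt_source x₁
  have hτ := (chartRep_change x₀ x₁ ω₀ hy hsrc).1
  have hnhds : ∀ᶠ z in 𝓝 y, z ∈ (extChartAt 𝓘(ℝ, E) x₀).target ∧
      (extChartAt 𝓘(ℝ, E) x₀).symm z ∈ (extChartAt 𝓘(ℝ, E) x₁).source :=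
    Filter.Eventually.and ((isOpen_extChartAt_target x₀).mem_nhds hy)
      ((continuousAt_extChartAt_symm'' hy).preimage_mem_nhds
        ((isOpen_extChartAt_source x₁).mem_nhds hsrc))
  refine ContDiffAt.congr_of_eventuallyEq (f := fun z =>
    (chartRep x₁ ω₀ (extChartAt 𝓘(ℝ, E) x₁ ((extChartAt 𝓘(ℝ, E) x₀).symm z))
      ).compContinuousLinearMap
        (fderiv ℝ (extChartAt 𝓘(ℝ, E) x₁ ∘ (extChartAt 𝓘(ℝ, E) x₀).symm) z)) ?_ ?_
  · refine contDiffAt_alt_comp ?_ (hτ.fderiv_right (m := ∞) (by simp))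
    exact ContDiffAt.comp y (g := chartRep x₁ ω₀) h1 hτ
  · filter_upwards [hnhds] with z hz
    exact (chartRep_change x₀ x₁ ω₀ hz.1 hz.2).2

theorem chartRep_extDerivField (ω₀ : DiffForm E M k) (x₀ : M) {y : E}
    (hy : y ∈ (extChartAt 𝓘(ℝ, E) x₀).target) :
    chartRep x₀ (extDerivField ω₀) y = extDeriv (chartRep x₀ ω₀) y := by
  set x₁ := (extChartAt 𝓘(ℝ, E) x₀).symm y with hx₁
  have hsrc : x₁ ∈ (extChartAt 𝓘(ℝ, E) x₁).source := mem_extChartAt_source x₁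
  obtain ⟨hτ, hrep⟩ := chartRep_change x₀ x₁ (extDerivField ω₀) hy hsrc
  have hnhds : ∀ᶠ z in 𝓝 y, z ∈ (extChartAt 𝓘(ℝ, E) x₀).target ∧
      (extChartAt 𝓘(ℝ, E) x₀).symm z ∈ (extChartAt 𝓘(ℝ, E) x₁).source :=
    Filter.Eventually.and ((isOpen_extChartAt_target x₀).mem_nhds hy)
      ((continuousAt_extChartAt_symm'' hy).preimage_mem_nhds
        ((isOpen_extChartAt_source x₁).mem_nhds hsrc))
  have heq : chartRep x₀ ω₀ =ᶠ[𝓝 y] fun z =>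
      (chartRep x₁ ω₀ ((extChartAt 𝓘(ℝ, E) x₁ ∘ (extChartAt 𝓘(ℝ, E) x₀).symm) z)
        ).compContinuousLinearMap
        (fderiv ℝ (extChartAt 𝓘(ℝ, E) x₁ ∘ (extChartAt 𝓘(ℝ, E) x₀).symm) z) := by
    filter_upwards [hnhds] with z hz
    exact (chartRep_change x₀ x₁ ω₀ hz.1 hz.2).2
  have hd : DifferentiableAt ℝ (chartRep x₁ ω₀)
      ((extChartAt 𝓘(ℝ, E) x₁ ∘ (extChartAt 𝓘(ℝ, E) x₀).symm) y) :=
    (contDiffAt_chartRep ω₀ x₁ (mem_extChartAt_target x₁)).differentiableAt (by simp)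
  rw [hrep, heq.extDeriv_eq, extDeriv_pullback hd hτ minSmoothness_two_le]
  congr 1
  change chartRep x₁ (extDerivField ω₀) (extChartAt 𝓘(ℝ, E) x₁ x₁)
    = extDeriv (chartRep x₁ ω₀) (extChartAt 𝓘(ℝ, E) x₁ x₁)
  rw [chartRep_self, extDerivField_eq]

theorem contMDiff_extDerivField (ω₀ : DiffForm E M k) :
    ContMDiff 𝓘(ℝ, E) (𝓘(ℝ, E).prod 𝓘(ℝ, E [⋀^Fin (k + 1)]→L[ℝ] ℝ)) ∞
      (fun x => Bundle.TotalSpace.mk' (E [⋀^Fin (k + 1)]→L[ℝ] ℝ) x (extDerivField ω₀ x)) := by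
  intro x₀
  rw [contMDiffAt_form_iff]
  refine (contDiffAt_extDeriv (contDiffAt_chartRep ω₀ x₀
    (mem_extChartAt_target x₀))).congr_of_eventuallyEq ?_
  filter_upwards [extChartAt_target_mem_nhds (I := 𝓘(ℝ, E)) x₀] with y hy
  exact chartRep_extDerivField ω₀ x₀ hy

theorem contMDiff_contractField (v : VecField E M) (ω₀ : DiffForm E M (k + 1)) :
    ContMDiff 𝓘(ℝ, E) (𝓘(ℝ, E).prod 𝓘(ℝ, E [⋀^Fin k]→L[ℝ] ℝ)) ∞
      (fun x => Bundle.TotalSpace.mk' (E [⋀^Fin k]→L[ℝ] ℝ) x (contractField v ω₀ x)) := by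
  intro x₀
  rw [contMDiffAt_form_iff]
  refine ContDiffAt.congr_of_eventuallyEq
    (f := fun y => (chartRep x₀ ω₀ y).curryLeft (vecRep x₀ v y)) ?_ ?_
  · refine contDiffAt_alt_iff.2 fun u => ?_
    refine contDiffAt_alt_apply (u := fun i y => Matrix.vecCons (vecRep x₀ v y) u i)
      (contDiffAt_chartRep ω₀ x₀ (mem_extChartAt_target x₀)) fun i => ?_
    refine Fin.cases ?_ (fun j => ?_) i
    · exact contDiffAt_vecRep (v.contMDiff x₀)
    · exact contDiffAt_const
  · filter_upwards [extChartAt_target_mem_nhds (I := 𝓘(ℝ, E)) x₀] with y hy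
    exact chartRep_contractField x₀ v ω₀ hy

theorem chartRep_add (x₀ : M) (ω₁ ω₂ : ∀ x : M, CotangentPower E M k x) :
    chartRep x₀ (ω₁ + ω₂) = chartRep x₀ ω₁ + chartRep x₀ ω₂ := rfl

theorem chartRep_smul (x₀ : M) (c : ℝ) (ω₁ : ∀ x : M, CotangentPower E M k x) :
    chartRep x₀ (c • ω₁) = c • chartRep x₀ ω₁ := rfl

variable (E M) in
/-- The exterior derivative `d : Ωᵏ(M) → Ωᵏ⁺¹(M)`. -/
def extD (k : ℕ) : DiffForm E M k →ₗ[ℝ] DiffForm E M (k + 1) where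
  toFun ω₀ := ⟨extDerivField ω₀, contMDiff_extDerivField ω₀⟩
  map_add' ω₁ ω₂ := by
    ext1 x
    change extDerivField _ x = extDerivField _ x + extDerivField _ x
    have h1 := contDiffAt_chartRep ω₁ x (mem_extChartAt_target x)
    have h2 := contDiffAt_chartRep ω₂ x (mem_extChartAt_target x)
    simp only [extDerivField_eq, ContMDiffSection.coe_add]
    rw [chartRep_add, extDeriv_add (h1.differentiableAt (by simp)) (h2.differentiableAt (by simp))]
    rfl
  map_smul' c ω₁ := by
    ext1 x
    change extDerivField _ x = c • extDerivField _ x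
    simp only [extDerivField_eq, ContMDiffSection.coe_smul]
    rw [chartRep_smul, extDeriv_smul]
    rfl

theorem extD_extD (ω₀ : DiffForm E M k) : extD E M (k + 1) (extD E M k ω₀) = 0 := by
  ext1 x
  change extDerivField (extDerivField ω₀) x = 0
  have : chartRep x (extDerivField ω₀) =ᶠ[𝓝 (extChartAt 𝓘(ℝ, E) x x)]
      extDeriv (chartRep x ω₀) := by
    filter_upwards [extChartAt_target_mem_nhds (I := 𝓘(ℝ, E)) x] with y hy
    exact chartRep_extDerivField ω₀ x hy
  rw [extDerivField_eq, this.extDeriv_eq]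
  exact extDeriv_extDeriv_apply (contDiffAt_chartRep ω₀ x (mem_extChartAt_target x))
    minSmoothness_two_le

theorem mlieBracket_eq_lieBracket (v w : VecField E M) (x : M) :
    VectorField.mlieBracket 𝓘(ℝ, E) v w x
      = VectorField.lieBracket ℝ (vecRep x v) (vecRep x w) (extChartAt 𝓘(ℝ, E) x x) := by
  let P : VecField E M → E → E := fun u => VectorField.mpullbackWithin 𝓘(ℝ, E) 𝓘(ℝ, E)
      (extChartAt 𝓘(ℝ, E) x).symm u Set.univ
  have key : ∀ u : VecField E M, P u =ᶠ[𝓝 (extChartAt 𝓘(ℝ, E) x x)] vecRep x u := by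
    intro u
    filter_upwards [extChartAt_target_mem_nhds (I := 𝓘(ℝ, E)) x] with y hy
    have h1 := mfderivWithin_extChartAt_symm_comp_mfderiv_extChartAt (I := 𝓘(ℝ, E)) hy
    have h2 := mfderiv_extChartAt_comp_mfderivWithin_extChartAt_symm (I := 𝓘(ℝ, E)) hy
    simp only [modelWithCornersSelf_coe, Set.range_id] at h1 h2
    have h3 := ContinuousLinearMap.inverse_eq h1 h2
    exact DFunLike.congr_fun h3 (u ((extChartAt 𝓘(ℝ, E) x).symm y))
  rw [← Filter.EventuallyEq.lieBracket_vectorField_eq (𝕜 := ℝ) (key v) (key w),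
    ← VectorField.lieBracketWithin_univ, ← VectorField.mlieBracketWithin_univ,
    VectorField.mlieBracketWithin_apply]
  simp only [modelWithCornersSelf_coe, Set.range_id, Set.preimage_univ, Set.univ_inter]
  have aux : ∀ (A : E →L[ℝ] E), A = ContinuousLinearMap.id ℝ E → ∀ u : E, A.inverse u = u := by
    rintro A rfl u
    rw [ContinuousLinearMap.inverse_id]
    rfl
  exact aux _ mfderiv_extChartAt_self _

variable (E M) in
/-- The contraction `(v, ω) ↦ ι_v ω`. -/
def contract (k : ℕ) : VecField E M →ₗ[ℝ] DiffForm E M (k + 1) →ₗ[ℝ] DiffForm E M k :=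
  LinearMap.mk₂ ℝ (fun v ω₀ => ⟨contractField v ω₀, contMDiff_contractField v ω₀⟩)
    (fun v w ω₀ => by
      ext1 x
      exact map_add (ContinuousAlternatingMap.curryLeft (E := E) (F := ℝ) (ω₀ x)) (v x) (w x))
    (fun c v ω₀ => by
      ext1 x
      exact map_smul (ContinuousAlternatingMap.curryLeft (E := E) (F := ℝ) (ω₀ x)) c (v x))
    (fun v ω₁ ω₂ => by ext1 x; rfl)
    (fun c v ω₁ => by ext1 x; rfl)

theorem contMDiff_mlieBracket (v w : VecField E M) :
    ContMDiff 𝓘(ℝ, E) (𝓘(ℝ, E).prod 𝓘(ℝ, E)) ∞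
      (fun x => Bundle.TotalSpace.mk' E x (VectorField.mlieBracket 𝓘(ℝ, E) v w x)) := by
  have : CompleteSpace E := FiniteDimensional.complete ℝ E
  have : IsManifold 𝓘(ℝ, E) (∞ + 1) M := ‹IsManifold 𝓘(ℝ, E) ∞ M›
  have : IsManifold 𝓘(ℝ, E) (minSmoothness ℝ 2) M := IsManifold.of_le minSmoothness_two_le
  intro x
  refine ContMDiffAt.mlieBracket_vectorField (n := ⊤) (m := ⊤) (v.contMDiff x) (w.contMDiff x) ?_
  rw [minSmoothness_of_isRCLikeNormedField]
  exact le_rfl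

/-- The Lie bracket of vector fields. -/
instance : Bracket (VecField E M) (VecField E M) where
  bracket v w := ⟨fun x => VectorField.mlieBracket 𝓘(ℝ, E) v w x, contMDiff_mlieBracket v w⟩

theorem bracket_apply (v w : VecField E M) (x : M) :
    ⁅v, w⁆ x = VectorField.mlieBracket 𝓘(ℝ, E) v w x := rfl

instance : LieRing (VecField E M) where
  add_lie u v w := by
    ext1 x
    exact VectorField.mlieBracket_add_left (u.contMDiff.mdifferentiable (by simp) x)
      (v.contMDiff.mdifferentiable (by simp) x)
  lie_add u v w := by
    ext1 x
    exact VectorField.mlieBracket_add_right (v.contMDiff.mdifferentiable (by simp) x)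
      (w.contMDiff.mdifferentiable (by simp) x)
  lie_self v := by
    ext1 x
    rw [bracket_apply, VectorField.mlieBracket_self]
    rfl
  leibniz_lie u v w := by
    have : CompleteSpace E := FiniteDimensional.complete ℝ E
    have : IsManifold 𝓘(ℝ, E) (minSmoothness ℝ 3) M := IsManifold.of_le minSmoothness_three_le
    ext1 x
    exact VectorField.leibniz_identity_mlieBracket_apply
      ((u.contMDiff x).of_le minSmoothness_two_le) ((v.contMDiff x).of_le minSmoothness_two_le)
      ((w.contMDiff x).of_le minSmoothness_two_le)

instance : LieAlgebra ℝ (VecField E M) where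
  lie_smul c v w := by
    ext1 x
    exact VectorField.mlieBracket_const_smul_right (w.contMDiff.mdifferentiable (by simp) x)

theorem curryLeft_swap {q : ℕ} (η : E [⋀^Fin (q + 2)]→L[ℝ] ℝ) (a b : E) :
    (η.curryLeft a).curryLeft b = - (η.curryLeft b).curryLeft a := by
  have h := ContinuousAlternatingMap.curryLeft_same η (a + b)
  have ha := ContinuousAlternatingMap.curryLeft_same η a
  have hb := ContinuousAlternatingMap.curryLeft_same η b
  rw [map_add, map_add] at h
  change (η.curryLeft a).curryLeft a + (η.curryLeft b).curryLeft a +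
    ((η.curryLeft a).curryLeft b + (η.curryLeft b).curryLeft b) = 0 at h
  rw [ha, hb, zero_add, add_zero, add_comm] at h
  exact eq_neg_of_add_eq_zero_left h

/-- `d(ι_w ι_v ω) = -ι_{[v,w]} ω` for Hamiltonian vector fields `v`, `w` of a closed form `ω`. -/
theorem extD_contract_contract {q : ℕ} (ω₀ : DiffForm E M (q + 2)) (hω : extD E M (q + 2) ω₀ = 0)
    (v w : VecField E M) (α β : DiffForm E M q)
    (hα : extD E M q α = -contract E M (q + 1) v ω₀)
    (hβ : extD E M q β = -contract E M (q + 1) w ω₀) :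
    extD E M q (contract E M q w (contract E M (q + 1) v ω₀))
      = -contract E M (q + 1) ⁅v, w⁆ ω₀ := by
  have hdv : extD E M (q + 1) (contract E M (q + 1) v ω₀) = 0 := by
    rw [← neg_eq_zero, ← map_neg, ← hα, extD_extD]
  have hdw : extD E M (q + 1) (contract E M (q + 1) w ω₀) = 0 := by
    rw [← neg_eq_zero, ← map_neg, ← hβ, extD_extD]
  ext1 x
  have hx := mem_extChartAt_target (I := 𝓘(ℝ, E)) x
  have hmem := extChartAt_target_mem_nhds (I := 𝓘(ℝ, E)) x
  have hrep : ∀ u : VecField E M, chartRep x (contractField u ω₀)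
      =ᶠ[𝓝 (extChartAt 𝓘(ℝ, E) x x)]
        fun y => (chartRep x ω₀ y).curryLeft (vecRep x u y) := by
    intro u
    filter_upwards [hmem] with y hy
    exact chartRep_contractField x u ω₀ hy
  have hrep2 : chartRep x (contractField w (contractField v ω₀))
      =ᶠ[𝓝 (extChartAt 𝓘(ℝ, E) x x)]
        -(fun y => ((chartRep x ω₀ y).curryLeft (vecRep x w y)).curryLeft (vecRep x v y)) := by
    filter_upwards [hmem] with y hy
    rw [chartRep_contractField x w _ hy, chartRep_contractField x v _ hy, curryLeft_swap]
    rfl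
  have e0 : extDeriv (chartRep x ω₀) (extChartAt 𝓘(ℝ, E) x x) = 0 := by
    rw [← extDerivField_eq]
    exact congrArg (fun η : DiffForm E M (q + 3) => η x) hω
  have e1 : ∀ u : VecField E M, extD E M (q + 1) (contract E M (q + 1) u ω₀) = 0 →
      extDeriv (fun y => (chartRep x ω₀ y).curryLeft (vecRep x u y))
        (extChartAt 𝓘(ℝ, E) x x) = 0 := by
    intro u hu
    rw [← (hrep u).extDeriv_eq, ← extDerivField_eq]
    exact congrArg (fun η : DiffForm E M (q + 2) => η x) hu
  have cartan := curryLeft_lieBracket (ω₀ := chartRep x ω₀) (v := vecRep x v) (w := vecRep x w)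
    (p := extChartAt 𝓘(ℝ, E) x x)
    ((contDiffAt_chartRep ω₀ x hx).differentiableAt (by simp))
    ((contDiffAt_vecRep (v.contMDiff x)).differentiableAt (by simp))
    ((contDiffAt_vecRep (w.contMDiff x)).differentiableAt (by simp))
  rw [e0, e1 v hdv, e1 w hdw, ← mlieBracket_eq_lieBracket, chartRep_self] at cartan
  have z1 : ∀ {r : ℕ} (a : E),
      ContinuousAlternatingMap.curryLeft (0 : E [⋀^Fin (r + 1)]→L[ℝ] ℝ) a = 0 := fun a => rfl
  rw [z1, z1, z1, z1, add_zero, sub_zero, sub_zero] at cartan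
  change extDerivField (contractField w (contractField v ω₀)) x
    = -(ContinuousAlternatingMap.curryLeft (E := E) (F := ℝ) (ω₀ x)
        (VectorField.mlieBracket 𝓘(ℝ, E) v w x))
  rw [extDerivField_eq, hrep2.extDeriv_eq]
  refine Eq.trans ?_ (congrArg Neg.neg cartan).symm
  have := extDeriv_smul (-1 : ℝ)
    (fun y => ((chartRep x ω₀ y).curryLeft (vecRep x w y)).curryLeft (vecRep x v y))
    (x := extChartAt 𝓘(ℝ, E) x x)
  rw [neg_one_smul, neg_one_smul] at this
  exact this

end Forms

section DeRham

variable (E : Type*) [NormedAddCommGroup E] [NormedSpace ℝ E] [FiniteDimensional ℝ E]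
  (M : Type*) [TopologicalSpace M] [ChartedSpace E M] [IsManifold 𝓘(ℝ, E) ∞ M]

/-- The space of closed `k`-forms. -/
def closedForms (k : ℕ) : Submodule ℝ (DiffForm E M k) := LinearMap.ker (extD E M k)

/-- The space of exact `k`-forms. -/
def exactForms : ∀ k : ℕ, Submodule ℝ (DiffForm E M k)
  | 0 => ⊥
  | k + 1 => LinearMap.range (extD E M k)

/-- De Rham cohomology `Hᵏ_dR(M)`. -/
abbrev DeRhamCohomology (k : ℕ) : Type _ :=
  closedForms E M k ⧸ (exactForms E M k).submoduleOf (closedForms E M k)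

end DeRham

section ChevalleyEilenberg

variable (𝔤 : Type*) [LieRing 𝔤] [LieAlgebra ℝ 𝔤]

/-- For a cochain `c`, the map `X ↦ Y ↦ c([X, Y], ·, …, ·)`. -/
def bracketInsert {q : ℕ} (c : 𝔤 [⋀^Fin (q + 1)]→ₗ[ℝ] ℝ) : 𝔤 →ₗ[ℝ] 𝔤 →ₗ[ℝ] 𝔤 [⋀^Fin q]→ₗ[ℝ] ℝ :=
  LinearMap.mk₂ ℝ (fun X Y => c.curryLeft ⁅X, Y⁆) (fun X X' Y => by simp) (fun a X Y => by simp)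
    (fun X Y Y' => by simp) (fun a X Y => by simp)

/-- The Chevalley–Eilenberg differential with trivial coefficients; `ceD_apply` is the usual
formula `(δc)(X₁, …) = ∑_{i<j} (-1)^(i+j) c([Xᵢ, Xⱼ], X₁, …, X̂ᵢ, …, X̂ⱼ, …)`. -/
def ceD : ∀ q : ℕ, (𝔤 [⋀^Fin q]→ₗ[ℝ] ℝ) → (𝔤 [⋀^Fin (q + 1)]→ₗ[ℝ] ℝ)
  | 0, _ => 0
  | _ + 1, c => -(2⁻¹ : ℝ) • AlternatingMap.alternatizeUncurryFin
      (AlternatingMap.alternatizeUncurryFinLM ∘ₗ bracketInsert 𝔤 c)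

/-- The pairs `i < j` are `(i.castSucc, j.succ)` with `i ≤ j`, whence the sign `-(-1)^(i+j)`. -/
theorem ceD_apply (q : ℕ) (c : 𝔤 [⋀^Fin (q + 1)]→ₗ[ℝ] ℝ) (X : Fin (q + 2) → 𝔤) :
    ceD 𝔤 (q + 1) c X = ∑ i : Fin (q + 1), ∑ j ≥ i, -(-1 : ℝ) ^ ((i : ℕ) + (j : ℕ)) *
      c (Matrix.vecCons ⁅X i.castSucc, X j.succ⁆ (j.removeNth (i.castSucc.removeNth X))) := by
  have h := AlternatingMap.alternatizeUncurryFin_alternatizeUncurryFinLM_comp_apply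
    (bracketInsert 𝔤 c) X
  rw [ceD, AlternatingMap.smul_apply, h, Finset.smul_sum]
  refine Finset.sum_congr rfl fun i _ => ?_
  rw [Finset.smul_sum]
  refine Finset.sum_congr rfl fun j _ => ?_
  have h1 : ∀ Y Z u, bracketInsert 𝔤 c Y Z u = c (Matrix.vecCons ⁅Y, Z⁆ u) := fun _ _ _ => rfl
  have h2 : bracketInsert 𝔤 c (X j.succ) (X i.castSucc)
      = -bracketInsert 𝔤 c (X i.castSucc) (X j.succ) := by
    change c.curryLeft ⁅X j.succ, X i.castSucc⁆ = -c.curryLeft ⁅X i.castSucc, X j.succ⁆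
    rw [← lie_skew, map_neg]
  rw [h2, AlternatingMap.neg_apply, h1, zsmul_eq_mul, smul_eq_mul]
  push_cast
  ring

end ChevalleyEilenberg

section LInfinity

/-- The data of an `L_∞`-algebra on `V`: a grading and multibrackets `l_k`, `k ≥ 1`
(`br 0` is not used). -/
structure LInftyData (V : Type*) [AddCommGroup V] [Module ℝ V] where
  deg : ℤ → Submodule ℝ V
  br : ∀ k : ℕ, MultilinearMap ℝ (fun _ : Fin k => V) V

/-- The Koszul sign `ε(σ; x₁, …, x_N)` for arguments of degrees `d₁, …, d_N`. -/
def koszulSign {N : ℕ} (σ : Equiv.Perm (Fin N)) (d : Fin N → ℤ) : ℤˣ :=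
  ∏ a : Fin N, ∏ b : Fin N,
    if a < b ∧ σ b < σ a then Int.negOnePow (d (σ a) * d (σ b)) else 1

/-- The consecutive entries `y_{s+1}, …, y_{s+len}` of `y` (only used for `s + len ≤ N`). -/
def block {V : Type*} [Zero V] {N : ℕ} (y : Fin N → V) (s len : ℕ) : Fin len → V :=
  fun t => if h : s + t < N then y ⟨s + t, h⟩ else 0

/-- The number of indices in the blocks before block `r`. -/
def blockStart {p : ℕ} (κ : Fin p → ℕ) (r : Fin p) : ℕ := ∑ s ∈ Finset.univ.filter (· < r), κ s

/-- `σ ∈ ush(κ₁, …, κ_p)`: `σ` is increasing on each of the consecutive blocks of lengths `κ_r`. -/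
def IsUnshuffle {N p : ℕ} (κ : Fin p → ℕ) (σ : Equiv.Perm (Fin N)) : Prop :=
  ∀ r : Fin p, ∀ a b : Fin N, blockStart κ r ≤ a → a < b → (b : ℕ) < blockStart κ r + κ r →
    σ a < σ b

instance {N p : ℕ} (κ : Fin p → ℕ) (σ : Equiv.Perm (Fin N)) : Decidable (IsUnshuffle κ σ) := by
  unfold IsUnshuffle; infer_instance

/-- If neighbouring blocks have equal lengths, then `σ` takes a smaller value at the first index of
the first one than at the first index of the second one. -/
def IsBlockOrdered {N p : ℕ} (κ : Fin p → ℕ) (σ : Equiv.Perm (Fin N)) : Prop :=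
  ∀ r s : Fin p, (s : ℕ) = r + 1 → κ r = κ s →
    ∀ a b : Fin N, (a : ℕ) = blockStart κ r → (b : ℕ) = blockStart κ s → σ a < σ b

instance {N p : ℕ} (κ : Fin p → ℕ) (σ : Equiv.Perm (Fin N)) : Decidable (IsBlockOrdered κ σ) := by
  unfold IsBlockOrdered; infer_instance

/-- The exponent `β` in the definition of an `L_∞`-morphism, for arguments whose degrees after
permutation are `e`. -/
def betaExponent {N p : ℕ} (κ : Fin p → ℕ) (e : Fin N → ℤ) : ℤ :=
  ((p * (p - 1) / 2 : ℕ) : ℤ) + ∑ r : Fin p, (κ r : ℤ) * ((p : ℤ) - ((r : ℕ) + 1))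
    + ∑ r : Fin p, ((κ r : ℤ) - 1) *
        ∑ i ∈ Finset.univ.filter (fun i : Fin N => (i : ℕ) < blockStart κ r), e i

/-- Left-hand side of the equation for `L_∞`-morphisms, for arguments `x` of degrees `d`. -/
def morphismLHS {V W : Type*} [AddCommGroup V] [Module ℝ V] [AddCommGroup W] [Module ℝ W]
    (L : LInftyData V) (f : ∀ k : ℕ, MultilinearMap ℝ (fun _ : Fin k => V) W)
    {N : ℕ} (d : Fin N → ℤ) (x : Fin N → V) : W :=
  ∑ i ∈ Finset.Icc 1 N, ∑ σ ∈ Finset.univ.filter (fun σ : Equiv.Perm (Fin N) =>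
      IsUnshuffle ![i, N - i] σ),
    (Int.negOnePow (i * (N + 1 - i + 1)) * Equiv.Perm.sign σ * koszulSign σ d) •
      f (N - i + 1) (Matrix.vecCons (L.br i (block (x ∘ σ) 0 i)) (block (x ∘ σ) i (N - i)))

/-- Right-hand side of the equation for `L_∞`-morphisms, for arguments `x` of degrees `d`. -/
def morphismRHS {V W : Type*} [AddCommGroup V] [Module ℝ V] [AddCommGroup W] [Module ℝ W]
    (L' : LInftyData W) (f : ∀ k : ℕ, MultilinearMap ℝ (fun _ : Fin k => V) W)
    {N : ℕ} (d : Fin N → ℤ) (x : Fin N → V) : W :=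
  ∑ p ∈ Finset.Icc 1 N,
    ∑ κ ∈ (Finset.Nat.antidiagonalTuple p N).filter (fun κ => (∀ r, 1 ≤ κ r) ∧ Monotone κ),
      ∑ σ ∈ Finset.univ.filter (fun σ : Equiv.Perm (Fin N) => IsUnshuffle κ σ ∧ IsBlockOrdered κ σ),
        (Int.negOnePow (betaExponent κ (d ∘ σ)) * Equiv.Perm.sign σ * koszulSign σ d) •
          L'.br p (fun r => f (κ r) (block (x ∘ σ) (blockStart κ r) (κ r)))

/-- `L_∞`-morphisms: families of graded skew-symmetric maps `f_k`, `k ≥ 1`, of degree `1 - k`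
(`f 0` is not used) compatible with all brackets. -/
structure LInftyMorphism {V W : Type*} [AddCommGroup V] [Module ℝ V] [AddCommGroup W] [Module ℝ W]
    (L : LInftyData V) (L' : LInftyData W) where
  f : ∀ k : ℕ, MultilinearMap ℝ (fun _ : Fin k => V) W
  map_degree : ∀ k : ℕ, 1 ≤ k → ∀ (d : Fin k → ℤ) (x : Fin k → V), (∀ i, x i ∈ L.deg (d i)) →
    f k x ∈ L'.deg (1 - k + ∑ i, d i)
  map_perm : ∀ k : ℕ, 1 ≤ k → ∀ (d : Fin k → ℤ) (x : Fin k → V), (∀ i, x i ∈ L.deg (d i)) →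
    ∀ σ : Equiv.Perm (Fin k), f k (x ∘ σ) = (Equiv.Perm.sign σ * koszulSign σ d) • f k x
  map_br : ∀ N : ℕ, 1 ≤ N → ∀ (d : Fin N → ℤ) (x : Fin N → V), (∀ i, x i ∈ L.deg (d i)) →
    morphismLHS L f d x = morphismRHS L' f d x

/-- The multilinear map `x ↦ B x₁ x₂`. -/
def bilinearBr {V : Type*} [AddCommGroup V] [Module ℝ V] (B : V →ₗ[ℝ] V →ₗ[ℝ] V) :
    MultilinearMap ℝ (fun _ : Fin 2 => V) V :=
  LinearMap.uncurryLeft (M := fun _ : Fin 2 => V)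
    (MultilinearMap.ofSubsingletonₗ ℝ ℝ V V (0 : Fin 1) ∘ₗ B)

theorem bilinearBr_apply {V : Type*} [AddCommGroup V] [Module ℝ V] (B : V →ₗ[ℝ] V →ₗ[ℝ] V)
    (x : Fin 2 → V) : bilinearBr B x = B (x 0) (x 1) := rfl

/-- A Lie algebra, as an `L_∞`-algebra concentrated in degree `0`. -/
def lieLInfty (𝔤 : Type*) [LieRing 𝔤] [LieAlgebra ℝ 𝔤] : LInftyData 𝔤 where
  deg i := if i = 0 then ⊤ else ⊥
  br
    | 2 => bilinearBr (LieModule.toEnd ℝ 𝔤 𝔤 : 𝔤 →ₗ[ℝ] 𝔤 →ₗ[ℝ] 𝔤)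
    | _ => 0

end LInfinity

section Observables

variable {E : Type*} [NormedAddCommGroup E] [NormedSpace ℝ E] [FiniteDimensional ℝ E]
  {M : Type*} [TopologicalSpace M] [ChartedSpace E M] [IsManifold 𝓘(ℝ, E) ∞ M]

variable (E M) in
/-- The iterated contraction `(v₁, …, v_k) ↦ (ω ↦ ι_{v_k} … ι_{v_1} ω)`. -/
def iterContract (q : ℕ) : ∀ k : ℕ, MultilinearMap ℝ (fun _ : Fin k => VecField E M)
    (DiffForm E M (q + k) →ₗ[ℝ] DiffForm E M q)
  | 0 => MultilinearMap.constOfIsEmpty ℝ _ LinearMap.id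
  | k + 1 => LinearMap.uncurryLeft (M := fun _ : Fin (k + 1) => VecField E M)
      { toFun := fun v =>
          (LinearMap.lcomp ℝ _ (contract E M (q + k) v)).compMultilinearMap (iterContract q k)
        map_add' := fun v w => by
          ext u η
          simp
        map_smul' := fun c v => by
          ext u η
          simp }

theorem iterContract_zero (q : ℕ) (v : Fin 0 → VecField E M) (η : DiffForm E M q) :
    iterContract E M q 0 v η = η := rfl

theorem iterContract_succ (q k : ℕ) (v : Fin (k + 1) → VecField E M)
    (η : DiffForm E M (q + k + 1)) :
    iterContract E M q (k + 1) v η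
      = iterContract E M q k (fun i => v i.succ) (contract E M (q + k) (v 0) η) := rfl

variable {m : ℕ}

/-- `L₀ = {(v, α) ∈ 𝔛(M) × Ωᵐ(M) | dα = -ι_v ω}` for `ω ∈ Ωᵐ⁺²(M)`. -/
def hamiltonianPairs (ω₀ : DiffForm E M (m + 2)) : Submodule ℝ (VecField E M × DiffForm E M m) where
  carrier := {x | extD E M m x.2 = -contract E M (m + 1) x.1 ω₀}
  add_mem' {x y} hx hy := by
    simp only [Set.mem_ofPred_eq] at hx hy ⊢
    simp only [Prod.snd_add, Prod.fst_add, map_add, LinearMap.add_apply, hx, hy]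
    abel
  zero_mem' := by simp
  smul_mem' c x hx := by
    simp only [Set.mem_ofPred_eq] at hx ⊢
    rw [Prod.smul_snd, Prod.smul_fst, map_smul, map_smul, LinearMap.smul_apply, hx]
    exact smul_neg c (contract E M (m + 1) x.1 ω₀)

/-- The underlying space of `L(M, ω)`: pairs of an element of `L₀` and a family of forms of
degrees `q = 0, …, m - 1`. With `n = m + 1`, the `q`-forms are the summand of
degree `q - (n - 1) = q - m`. -/
abbrev ObsSpace (ω₀ : DiffForm E M (m + 2)) : Type _ :=
  hamiltonianPairs ω₀ × (∀ q : Fin m, DiffForm E M q)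

/-- The summand of degree `i` of `L(M, ω)`. -/
def obsDeg (ω₀ : DiffForm E M (m + 2)) (i : ℤ) : Submodule ℝ (ObsSpace ω₀) where
  carrier := {x | (i ≠ 0 → x.1 = 0) ∧ ∀ q : Fin m, (q : ℤ) - m ≠ i → x.2 q = 0}
  add_mem' {x y} hx hy := by
    refine ⟨fun h => ?_, fun q h => ?_⟩
    · rw [Prod.fst_add, hx.1 h, hy.1 h, add_zero]
    · rw [Prod.snd_add, Pi.add_apply, hx.2 q h, hy.2 q h, add_zero]
  zero_mem' := ⟨fun _ => rfl, fun _ _ => rfl⟩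
  smul_mem' c x hx := by
    refine ⟨fun h => ?_, fun q h => ?_⟩
    · rw [Prod.smul_fst, hx.1 h, smul_zero]
    · rw [Prod.smul_snd, Pi.smul_apply, hx.2 q h, smul_zero]

/-- The `L₀`-component of `l₁`: `α ↦ (0, dα)` on forms of degree `m - 1`. -/
def l1Top : ∀ {m : ℕ} (ω₀ : DiffForm E M (m + 2)),
    (∀ q : Fin m, DiffForm E M q) →ₗ[ℝ] hamiltonianPairs ω₀
  | 0, _ => 0
  | m + 1, ω₀ => LinearMap.codRestrict (hamiltonianPairs ω₀)
      (LinearMap.inr ℝ (VecField E M) (DiffForm E M (m + 1)) ∘ₗ extD E M m ∘ₗ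
        LinearMap.proj (Fin.last m))
      (fun η => by
        change extD E M (m + 1) (extD E M m (η (Fin.last m)))
          = -contract E M (m + 2) (0 : VecField E M) ω₀
        rw [extD_extD, map_zero, LinearMap.zero_apply, neg_zero])

/-- The component of `l₁` in forms of degree `q < m`: the differential of the component of
degree `q - 1`. -/
def l1Form : ∀ q : Fin m, (∀ q : Fin m, DiffForm E M q) →ₗ[ℝ] DiffForm E M q
  | ⟨0, _⟩ => 0
  | ⟨j + 1, h⟩ => extD E M j ∘ₗ LinearMap.proj (⟨j, Nat.lt_of_succ_lt h⟩ : Fin m)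

/-- The unary bracket of `L(M, ω)`; it vanishes on `L₀`. -/
def obsL1 (ω₀ : DiffForm E M (m + 2)) : ObsSpace ω₀ →ₗ[ℝ] ObsSpace ω₀ :=
  (LinearMap.prod (l1Top ω₀) (LinearMap.pi l1Form)) ∘ₗ LinearMap.snd ℝ _ _

/-- `((v, α), (w, β)) ↦ ([v, w], ι_w ι_v ω)` on `L₀`. -/
def l2Top (ω₀ : DiffForm E M (m + 2)) (hω : extD E M (m + 2) ω₀ = 0) :
    hamiltonianPairs ω₀ →ₗ[ℝ] hamiltonianPairs ω₀ →ₗ[ℝ] hamiltonianPairs ω₀ :=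
  LinearMap.mk₂ ℝ
    (fun x y => ⟨(⁅x.1.1, y.1.1⁆, contract E M m y.1.1 (contract E M (m + 1) x.1.1 ω₀)),
      extD_contract_contract ω₀ hω x.1.1 y.1.1 x.1.2 y.1.2 x.2 y.2⟩)
    (fun x x' y => by ext1; simp)
    (fun c x y => by ext1; simp)
    (fun x y y' => by ext1; simp)
    (fun c x y => by ext1; simp)

/-- The binary bracket of `L(M, ω)`. -/
def obsL2 (ω₀ : DiffForm E M (m + 2)) (hω : extD E M (m + 2) ω₀ = 0) :
    ObsSpace ω₀ →ₗ[ℝ] ObsSpace ω₀ →ₗ[ℝ] ObsSpace ω₀ :=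
  LinearMap.compr₂ ((l2Top ω₀ hω).compl₁₂ (LinearMap.fst ℝ _ _) (LinearMap.fst ℝ _ _))
    (LinearMap.inl ℝ _ _)

/-- The vector field of the `L₀`-component. -/
def obsVec (ω₀ : DiffForm E M (m + 2)) : ObsSpace ω₀ →ₗ[ℝ] VecField E M :=
  LinearMap.fst ℝ _ _ ∘ₗ (hamiltonianPairs ω₀).subtype ∘ₗ LinearMap.fst ℝ _ _

/-- The component in forms of degree `q` of the bracket `l_k`, `k ≥ 3`:
`-(-1)^(k(k+1)/2) ι_{v_k} … ι_{v_1} ω` if this is a `q`-form, and `0` otherwise. -/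
def lkForm (ω₀ : DiffForm E M (m + 2)) (k q : ℕ) :
    MultilinearMap ℝ (fun _ : Fin k => ObsSpace ω₀) (DiffForm E M q) :=
  if h : m + 2 = q + k then
    (-(-1 : ℝ) ^ (k * (k + 1) / 2)) •
      (LinearMap.applyₗ (h ▸ ω₀ : DiffForm E M (q + k))).compMultilinearMap
        ((iterContract E M q k).compLinearMap (fun _ => obsVec ω₀))
  else 0

/-- The Lie `n`-algebra of observables `L(M, ω)`, `n = m + 1`. -/
def observables (ω₀ : DiffForm E M (m + 2)) (hω : extD E M (m + 2) ω₀ = 0) :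
    LInftyData (ObsSpace ω₀) where
  deg := obsDeg ω₀
  br
    | 0 => 0
    | 1 => MultilinearMap.ofSubsingletonₗ ℝ ℝ _ _ (0 : Fin 1) (obsL1 ω₀)
    | 2 => bilinearBr (V := ObsSpace ω₀) (obsL2 ω₀ hω)
    | k + 3 => (LinearMap.inr ℝ (hamiltonianPairs ω₀) (∀ q : Fin m, DiffForm E M q)
        ).compMultilinearMap (MultilinearMap.pi fun q : Fin m => lkForm ω₀ (k + 3) q)

variable {𝔤 : Type*} [LieRing 𝔤] [LieAlgebra ℝ 𝔤]

/-- The action `ζ` has a weak co-moment map: a linear lift of `ζ` along `L₀ → 𝔛(M)`. -/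
def IsWeaklyHamiltonian (ω₀ : DiffForm E M (m + 2)) (ζ : 𝔤 →ₗ⁅ℝ⁆ VecField E M) : Prop :=
  ∃ j : 𝔤 →ₗ[ℝ] hamiltonianPairs ω₀, ∀ X : 𝔤, (j X).1.1 = ζ X

/-- The `L_∞`-morphism `F : 𝔤 → L(M, ω)` lifts `ζ` along `L₀ → 𝔛(M)`. -/
def IsHomotopyComomentMap {ω₀ : DiffForm E M (m + 2)} {hω : extD E M (m + 2) ω₀ = 0}
    (F : LInftyMorphism (lieLInfty 𝔤) (observables ω₀ hω)) (ζ : 𝔤 →ₗ⁅ℝ⁆ VecField E M) : Prop :=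
  ∀ X : 𝔤, obsVec ω₀ (F.f 1 (fun _ => X)) = ζ X

/-- The value `X ↦ ζ(X)|_p` of the action at `p`. -/
def actionAt (ζ : 𝔤 →ₗ⁅ℝ⁆ VecField E M) (p : M) : 𝔤 →ₗ[ℝ] TangentSpace 𝓘(ℝ, E) p where
  toFun X := ζ X p
  map_add' X Y := by rw [map_add]; rfl
  map_smul' c X := by rw [map_smul]; rfl

/-- The cochain
`c_p(X₁, …, X_{n+1}) = -(-1)ⁿ (-1)^(n(n+1)/2) ω(ζ(X₁), …, ζ(X_{n+1}))|_p`, with `n = m + 1`. -/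
def momentCochain (ω₀ : DiffForm E M (m + 2)) (ζ : 𝔤 →ₗ⁅ℝ⁆ VecField E M) (p : M) :
    𝔤 [⋀^Fin (m + 2)]→ₗ[ℝ] ℝ :=
  (-(-1 : ℝ) ^ (m + 1) * (-1 : ℝ) ^ ((m + 1) * (m + 2) / 2)) •
    AlternatingMap.compLinearMap
      (ContinuousAlternatingMap.toAlternatingMap (M := TangentSpace 𝓘(ℝ, E) p) (N := ℝ) (ω₀ p))
      (actionAt ζ p)

end Observables

end NPlectic

end

/-! Write ι_X for contraction with ζ(X), L_X = dι_X + ι_X d, and C_k(X_1, …, X_k) = ι_{X_1} ⋯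
ι_{X_k} ω, with n = m + 1. As 𝔤 sits in degree 0 and the brackets of arity at least 2 on L(M, ω)
only see L_0, most terms of the morphism equations vanish (`morphismLHS_lie_zero`,
`morphismRHS_eq`). What remains is a tower of equations for alternating maps F_k from 𝔤 to forms of
degree m + 1 - k, starting at F_0 = 0: d F_{k+1} = -δF_k + (-1)^(k+1) C_{k+1}, where δ is the
Chevalley–Eilenberg differential of form-valued cochains. The right-hand side is
`actionObstruction`.

The tower can be climbed because each new right-hand side is closed. The form ι_X ω is exact and ω
is closed, so L_X ω = 0; together with [L_X, ι_Y] = ι_{[X,Y]} this gives dC_{k+1} = -δC_k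
(`d_contractCochain`). Since δ² = 0, the two contributions to the differential of the right-hand
side then cancel (`d_obstruction_succ`).

For k = 0 a primitive exists because the action is weakly Hamiltonian. For 1 ≤ k ≤ m the right-hand
side is a closed form of degree m + 1 - k, between 1 and m, hence exact. Primitives are picked by a
linear map, so the F_k stay alternating and multilinear. For k = m + 1 there is no form left to
choose and the right-hand side must vanish. It is a closed function, constant by connectedness, with
value c_p - δ(ev_p F_{m+1}) at p. Adding constants to F_{m+1} does not affect the earlier equations,
so one may arrange ev_p F_{m+1} = b, and then δb = c_p finishes the proof (`exists_components`). -/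

noncomputable section

namespace NPlectic

/-! ### Chevalley–Eilenberg cochains with values in a trivial module -/

section Cochains

variable {𝔤 : Type*} [LieRing 𝔤] [LieAlgebra ℝ 𝔤]
  {W : Type*} [AddCommGroup W] [Module ℝ W] {W' : Type*} [AddCommGroup W'] [Module ℝ W']

open AlternatingMap

/-- Lets identities between cochains be proved by induction on the degree, inserting one argument
and applying Cartan-type formulas. -/
theorem curryLeft_ext {q : ℕ} {c c' : 𝔤 [⋀^Fin (q + 1)]→ₗ[ℝ] W}
    (h : ∀ X, c.curryLeft X = c'.curryLeft X) : c = c' := by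
  ext u
  have := congrArg (fun g => g (Fin.tail u)) (h (u 0))
  simp only [curryLeft_apply_apply] at this
  rwa [show Matrix.vecCons (u 0) (Fin.tail u) = u from Fin.cons_self_tail u] at this

theorem curryLeft_curryLeft_swap {q : ℕ} (c : 𝔤 [⋀^Fin (q + 2)]→ₗ[ℝ] W) (X Y : 𝔤) :
    (c.curryLeft X).curryLeft Y = -(c.curryLeft Y).curryLeft X := by
  have h := curryLeft_same c (X + Y)
  have hX := curryLeft_same c X
  have hY := curryLeft_same c Y
  rw [map_add, map_add, curryLeft_add, LinearMap.add_apply, LinearMap.add_apply, hX, hY,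
    zero_add, add_zero, add_comm] at h
  exact eq_neg_of_add_eq_zero_left h

/-- The summand with index 0 feeds `v` to `A`. In the others `v` becomes the first argument of the
value of `A`, and the index shift by one produces the minus sign. -/
theorem curryLeft_alternatizeUncurryFin {q : ℕ} (A : 𝔤 →ₗ[ℝ] 𝔤 [⋀^Fin (q + 1)]→ₗ[ℝ] W) (v : 𝔤) :
    (alternatizeUncurryFin A).curryLeft v
      = A v - alternatizeUncurryFin (curryLeftLinearMap.flip v ∘ₗ A) := by
  ext u
  rw [AlternatingMap.sub_apply, curryLeft_apply_apply, alternatizeUncurryFin_apply,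
    alternatizeUncurryFin_apply]
  have h0 : (0 : Fin (q + 2)).removeNth (Matrix.vecCons v u) = u := by
    ext i; simp [Fin.removeNth]
  have hs : ∀ i : Fin (q + 1), i.succ.removeNth (Matrix.vecCons v u)
      = Matrix.vecCons v (i.removeNth u) := by
    intro i
    ext j
    refine Fin.cases ?_ (fun j => ?_) j <;> simp [Fin.removeNth]
  have hc : ∀ X w, ((curryLeftLinearMap.flip v ∘ₗ A) X) w = A X (Matrix.vecCons v w) :=
    fun _ _ => rfl
  rw [Fin.sum_univ_succ, h0]
  simp only [hs, hc, Matrix.cons_val_zero, Matrix.cons_val_succ, Fin.val_zero, Fin.val_succ,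
    pow_zero, one_smul, pow_succ, mul_neg, mul_one, neg_smul, Finset.sum_neg_distrib]
  rw [sub_eq_add_neg]

theorem curryLeft_alternatizeUncurryFin_zero (A : 𝔤 →ₗ[ℝ] 𝔤 [⋀^Fin 0]→ₗ[ℝ] W) (v : 𝔤) :
    (alternatizeUncurryFin A).curryLeft v = A v := by
  ext u
  rw [curryLeft_apply_apply, alternatizeUncurryFin_apply, Fin.sum_univ_succ,
    Finset.univ_eq_empty, Finset.sum_empty, add_zero, Fin.val_zero, pow_zero, one_smul]
  exact congrArg _ (Subsingleton.elim _ _)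

/-- For a cochain `c`, the map `X ↦ Y ↦ c([X, Y], ·, …, ·)`. -/
def lieInsert {q : ℕ} (c : 𝔤 [⋀^Fin (q + 1)]→ₗ[ℝ] W) :
    𝔤 →ₗ[ℝ] 𝔤 →ₗ[ℝ] 𝔤 [⋀^Fin q]→ₗ[ℝ] W :=
  LinearMap.mk₂ ℝ (fun X Y => c.curryLeft ⁅X, Y⁆) (fun X X' Y => by simp) (fun a X Y => by simp)
    (fun X Y Y' => by simp) (fun a X Y => by simp)

theorem lieInsert_apply {q : ℕ} (c : 𝔤 [⋀^Fin (q + 1)]→ₗ[ℝ] W) (X Y : 𝔤) :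
    lieInsert c X Y = c.curryLeft ⁅X, Y⁆ := rfl

/-- The Chevalley–Eilenberg differential of cochains with values in a trivial module `W`. -/
def ceDiff : ∀ q : ℕ, (𝔤 [⋀^Fin q]→ₗ[ℝ] W) →ₗ[ℝ] (𝔤 [⋀^Fin (q + 1)]→ₗ[ℝ] W)
  | 0 => 0
  | _ + 1 =>
    -- Alternating over both bracket slots meets every pair i < j twice, hence the factor 1/2.
    { toFun := fun c => -(2⁻¹ : ℝ) • alternatizeUncurryFinLM (alternatizeUncurryFinLM ∘ₗ lieInsert c)
      map_add' := fun c c' => by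
        rw [← smul_add, ← map_add, ← LinearMap.comp_add]
        rfl
      map_smul' := fun r c => by
        have h : lieInsert (r • c) = r • lieInsert c := rfl
        rw [RingHom.id_apply, smul_comm r, h, LinearMap.comp_smul, map_smul] }

theorem ceDiff_eq_ceD (q : ℕ) (c : 𝔤 [⋀^Fin q]→ₗ[ℝ] ℝ) : ceDiff q c = ceD 𝔤 q c := by
  cases q <;> rfl

/-- The Lie derivative of cochains with values in a trivial module. -/
def ceLie : ∀ q : ℕ, 𝔤 → (𝔤 [⋀^Fin q]→ₗ[ℝ] W) →ₗ[ℝ] (𝔤 [⋀^Fin q]→ₗ[ℝ] W)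
  | 0, _ => 0
  | _ + 1, X =>
    { toFun := fun c => -alternatizeUncurryFinLM (lieInsert c X)
      map_add' := fun c c' => by
        rw [← neg_add, ← map_add]
        rfl
      map_smul' := fun r c => by
        rw [RingHom.id_apply, smul_neg, ← map_smul]
        rfl }

/-- This is [L_X, ι_Y] = ι_{[X,Y]} for cochains; in the sum defining L_X the term that brackets X
with Y is split off. -/
theorem curryLeft_ceLie (q : ℕ) (X Y : 𝔤) (c : 𝔤 [⋀^Fin (q + 1)]→ₗ[ℝ] W) :
    (ceLie (q + 1) X c).curryLeft Y = ceLie q X (c.curryLeft Y) - c.curryLeft ⁅X, Y⁆ := by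
  change (-alternatizeUncurryFin (lieInsert c X)).curryLeft Y = _
  have hneg : ∀ a : 𝔤 [⋀^Fin (q + 1)]→ₗ[ℝ] W, (-a).curryLeft Y = -a.curryLeft Y := fun _ => rfl
  rw [hneg]
  cases q with
  | zero =>
    rw [curryLeft_alternatizeUncurryFin_zero]
    exact (zero_sub _).symm
  | succ q =>
    rw [curryLeft_alternatizeUncurryFin, lieInsert_apply]
    have : curryLeftLinearMap.flip Y ∘ₗ lieInsert c X = -lieInsert (c.curryLeft Y) X := by
      ext1 Z
      exact curryLeft_curryLeft_swap c _ _
    rw [this]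
    change -(c.curryLeft ⁅X, Y⁆ - alternatizeUncurryFinLM (-lieInsert (c.curryLeft Y) X))
      = -alternatizeUncurryFinLM (lieInsert (c.curryLeft Y) X) - c.curryLeft ⁅X, Y⁆
    rw [map_neg]
    abel

/-- Base case of Cartan's formula: the term δ(ι_X c) is absent because δ vanishes on 0-cochains. -/
theorem curryLeft_ceDiff_one (X : 𝔤) (c : 𝔤 [⋀^Fin 1]→ₗ[ℝ] W) :
    (ceDiff 1 c).curryLeft X = ceLie 1 X c := by
  change (-(2⁻¹ : ℝ) • alternatizeUncurryFin (alternatizeUncurryFinLM ∘ₗ lieInsert c)).curryLeft X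
    = -alternatizeUncurryFin (lieInsert c X)
  rw [curryLeft_smul, LinearMap.smul_apply, curryLeft_alternatizeUncurryFin]
  have : curryLeftLinearMap.flip X ∘ₗ alternatizeUncurryFinLM ∘ₗ lieInsert c = -lieInsert c X := by
    ext1 Y
    change (alternatizeUncurryFin (lieInsert c Y)).curryLeft X = -c.curryLeft ⁅X, Y⁆
    rw [curryLeft_alternatizeUncurryFin_zero, lieInsert_apply, ← lie_skew, map_neg]
  rw [this]
  change -(2⁻¹ : ℝ) • (alternatizeUncurryFin (lieInsert c X)
    - alternatizeUncurryFinLM (-lieInsert c X)) = _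
  rw [map_neg, sub_neg_eq_add]
  change -(2⁻¹ : ℝ) • (alternatizeUncurryFin (lieInsert c X)
    + alternatizeUncurryFin (lieInsert c X)) = _
  module

/-- Cartan's formula for the Chevalley–Eilenberg differential. -/
theorem curryLeft_ceDiff (q : ℕ) (X : 𝔤) (c : 𝔤 [⋀^Fin (q + 1)]→ₗ[ℝ] W) :
    (ceDiff (q + 1) c).curryLeft X = ceLie (q + 1) X c - ceDiff q (c.curryLeft X) := by
  cases q with
  | zero => rw [curryLeft_ceDiff_one]; exact (sub_zero _).symm
  | succ q =>
  change (-(2⁻¹ : ℝ) • alternatizeUncurryFin (alternatizeUncurryFinLM ∘ₗ lieInsert c)).curryLeft X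
    = -alternatizeUncurryFin (lieInsert c X) -
      -(2⁻¹ : ℝ) • alternatizeUncurryFinLM (alternatizeUncurryFinLM ∘ₗ lieInsert (c.curryLeft X))
  rw [curryLeft_smul, LinearMap.smul_apply, curryLeft_alternatizeUncurryFin]
  -- Inserting X into the inner alternatization either puts X in the bracket, giving the Lie
  -- derivative term, or among the remaining arguments, giving the differential of ι_X c.
  have : curryLeftLinearMap.flip X ∘ₗ alternatizeUncurryFinLM ∘ₗ lieInsert c
      = -lieInsert c X + alternatizeUncurryFinLM ∘ₗ lieInsert (c.curryLeft X) := by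
    ext1 Y
    change (alternatizeUncurryFin (lieInsert c Y)).curryLeft X
      = -c.curryLeft ⁅X, Y⁆ + alternatizeUncurryFinLM (lieInsert (c.curryLeft X) Y)
    rw [curryLeft_alternatizeUncurryFin, lieInsert_apply, ← lie_skew, map_neg]
    have h : curryLeftLinearMap.flip X ∘ₗ lieInsert c Y = -lieInsert (c.curryLeft X) Y := by
      ext1 Z
      exact curryLeft_curryLeft_swap c _ _
    rw [h]
    change _ - alternatizeUncurryFinLM (-lieInsert (c.curryLeft X) Y) = _
    rw [map_neg, sub_neg_eq_add]
  rw [this]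
  change -(2⁻¹ : ℝ) • (alternatizeUncurryFin (lieInsert c X) - alternatizeUncurryFinLM
    (-lieInsert c X + alternatizeUncurryFinLM ∘ₗ lieInsert (c.curryLeft X))) = _
  rw [map_add, map_neg]
  change -(2⁻¹ : ℝ) • (alternatizeUncurryFin (lieInsert c X)
    - (-alternatizeUncurryFin (lieInsert c X) + _)) = _
  module

theorem curryLeft_sub {q : ℕ} (c c' : 𝔤 [⋀^Fin (q + 1)]→ₗ[ℝ] W) (X : 𝔤) :
    (c - c').curryLeft X = c.curryLeft X - c'.curryLeft X := rfl

/-- The Jacobi identity, transported through [L_X, ι_Z] = ι_{[X,Z]}. -/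
theorem ceLie_lie (q : ℕ) (X Y : 𝔤) (c : 𝔤 [⋀^Fin q]→ₗ[ℝ] W) :
    ceLie q X (ceLie q Y c) - ceLie q Y (ceLie q X c) = ceLie q ⁅X, Y⁆ c := by
  induction q with
  | zero => exact sub_zero _
  | succ q ih =>
    refine curryLeft_ext fun Z => ?_
    have hJ : c.curryLeft ⁅⁅X, Y⁆, Z⁆ = c.curryLeft ⁅X, ⁅Y, Z⁆⁆ - c.curryLeft ⁅Y, ⁅X, Z⁆⁆ := by
      rw [← map_sub, lie_lie]
    simp only [curryLeft_sub, curryLeft_ceLie, map_sub, ← ih, hJ]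
    abel

theorem ceLie_ceDiff (q : ℕ) (X : 𝔤) (c : 𝔤 [⋀^Fin q]→ₗ[ℝ] W) :
    ceLie (q + 1) X (ceDiff q c) = ceDiff q (ceLie q X c) := by
  induction q with
  | zero => exact map_zero _
  | succ q ih =>
    refine curryLeft_ext fun Y => ?_
    simp only [curryLeft_ceDiff, curryLeft_ceLie, map_sub, ih, ← ceLie_lie (q + 1) X Y c]
    abel

/-- By Cartan's formula twice, ι_X δδ = L_X δ - δL_X + δδι_X; the first two terms cancel and the
last vanishes by induction. -/
theorem ceDiff_ceDiff (q : ℕ) (c : 𝔤 [⋀^Fin q]→ₗ[ℝ] W) : ceDiff (q + 1) (ceDiff q c) = 0 := by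
  induction q with
  | zero => exact map_zero _
  | succ q ih =>
    refine curryLeft_ext fun X => ?_
    rw [curryLeft_ceDiff, curryLeft_ceDiff, map_sub, ih, ceLie_ceDiff]
    simp

theorem compAlternatingMap_ceLie (T : W →ₗ[ℝ] W') (q : ℕ) (X : 𝔤) (c : 𝔤 [⋀^Fin q]→ₗ[ℝ] W) :
    T.compAlternatingMap (ceLie q X c) = ceLie q X (T.compAlternatingMap c) := by
  induction q with
  | zero => ext; exact map_zero T
  | succ q ih =>
    refine curryLeft_ext fun Y => ?_
    rw [curryLeft_ceLie, curryLeft_compAlternatingMap, curryLeft_ceLie,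
      curryLeft_compAlternatingMap, curryLeft_compAlternatingMap, ← ih]
    ext u
    exact map_sub T _ _

/-- The differential acts on the arguments only, so it commutes with any linear map of the values.
Below, this map is d, a contraction, a projection to one form degree or evaluation at a point. -/
theorem compAlternatingMap_ceDiff (T : W →ₗ[ℝ] W') (q : ℕ) (c : 𝔤 [⋀^Fin q]→ₗ[ℝ] W) :
    T.compAlternatingMap (ceDiff q c) = ceDiff q (T.compAlternatingMap c) := by
  induction q with
  | zero => ext; exact map_zero T
  | succ q ih =>
    refine curryLeft_ext fun Y => ?_
    rw [curryLeft_ceDiff, curryLeft_compAlternatingMap, curryLeft_ceDiff,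
      curryLeft_compAlternatingMap, ← ih, ← compAlternatingMap_ceLie]
    ext u
    exact map_sub T _ _

/-- The pairs `i < j` are `(i.castSucc, j.succ)` with `i ≤ j`. -/
theorem ceDiff_apply (q : ℕ) (c : 𝔤 [⋀^Fin (q + 1)]→ₗ[ℝ] W) (X : Fin (q + 2) → 𝔤) :
    ceDiff (q + 1) c X = -∑ i : Fin (q + 1), ∑ j ≥ i, (-1 : ℤ) ^ ((i : ℕ) + (j : ℕ)) •
      c (Matrix.vecCons ⁅X i.castSucc, X j.succ⁆ (j.removeNth (i.castSucc.removeNth X))) := by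
  have h := alternatizeUncurryFin_alternatizeUncurryFinLM_comp_apply (lieInsert c) X
  change -(2⁻¹ : ℝ) • alternatizeUncurryFin (alternatizeUncurryFinLM ∘ₗ lieInsert c) X = _
  rw [h, ← Finset.sum_neg_distrib, Finset.smul_sum]
  refine Finset.sum_congr rfl fun i _ => ?_
  rw [Finset.smul_sum, ← Finset.sum_neg_distrib]
  refine Finset.sum_congr rfl fun j _ => ?_
  have h2 : lieInsert c (X j.succ) (X i.castSucc) = -lieInsert c (X i.castSucc) (X j.succ) := by
    rw [lieInsert_apply, lieInsert_apply, ← lie_skew, map_neg]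
  rw [h2, AlternatingMap.neg_apply]
  change -(2⁻¹ : ℝ) • (-1 : ℤ) ^ ((i : ℕ) + (j : ℕ)) • (c (Matrix.vecCons _ _) -
    -c (Matrix.vecCons _ _)) = _
  rw [smul_comm, sub_neg_eq_add, ← smul_neg]
  congr 1
  module

end Cochains

/-! ### Abstract Cartan calculus: contraction cochains and the obstruction -/

section CartanCalculus

variable {𝔤 : Type*} [LieRing 𝔤] [LieAlgebra ℝ 𝔤] {Ω : Type*} [AddCommGroup Ω] [Module ℝ Ω]

/-- The cochain `(X₁, …, X_k) ↦ ι_{X₁} … ι_{X_k} η` for an action of `𝔤` by contractions. -/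
def contractCochain (ι : 𝔤 →ₗ[ℝ] Module.End ℝ Ω) (hι : ∀ X, ι X * ι X = 0) (η : Ω) (k : ℕ) :
    𝔤 [⋀^Fin k]→ₗ[ℝ] Ω :=
  -- Since ι_X² = 0, the contractions extend to an algebra map from the exterior algebra of 𝔤, which
  -- makes the iterated contraction alternating at once.
  (LinearMap.applyₗ η ∘ₗ (ExteriorAlgebra.lift ℝ ⟨ι, hι⟩).toLinearMap).compAlternatingMap
    (ExteriorAlgebra.ιMulti ℝ k)

variable {ι : 𝔤 →ₗ[ℝ] Module.End ℝ Ω} {hι : ∀ X, ι X * ι X = 0} {d : Ω →ₗ[ℝ] Ω} {η : Ω}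

theorem contractCochain_zero (x : Fin 0 → 𝔤) : contractCochain ι hι η 0 x = η := by
  simp [contractCochain]

theorem contractCochain_succ (k : ℕ) (x : Fin (k + 1) → 𝔤) :
    contractCochain ι hι η (k + 1) x = ι (x 0) (contractCochain ι hι η k (fun i => x i.succ)) := by
  simp [contractCochain, ExteriorAlgebra.ιMulti_succ_apply]
  rfl

theorem curryLeft_contractCochain (k : ℕ) (X : 𝔤) :
    (contractCochain ι hι η (k + 1)).curryLeft X
      = (ι X).compAlternatingMap (contractCochain ι hι η k) := by
  ext u
  exact contractCochain_succ k _

/-- Contractions anticommute. -/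
theorem contractCochain_contract (k : ℕ) (X : 𝔤) (x : Fin k → 𝔤) :
    contractCochain ι hι (ι X η) k x = (-1 : ℝ) ^ k • ι X (contractCochain ι hι η k x) := by
  induction k with
  | zero => rw [contractCochain_zero, contractCochain_zero, pow_zero, one_smul]
  | succ k ih =>
    have hXY : ∀ Y (β : Ω), ι Y (ι X β) = -ι X (ι Y β) := fun Y β => by
      have h := LinearMap.congr_fun (hι (X + Y)) β
      have hX : ι X (ι X β) = 0 := LinearMap.congr_fun (hι X) β
      have hY : ι Y (ι Y β) = 0 := LinearMap.congr_fun (hι Y) β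
      simp only [map_add, Module.End.mul_apply, LinearMap.add_apply, hX, hY, zero_add, add_zero,
        LinearMap.zero_apply] at h
      exact eq_neg_of_add_eq_zero_left h
    rw [contractCochain_succ, ih, map_smul, hXY, contractCochain_succ, pow_succ]
    module

-- With L_X = dι_X + ι_X d, these say [L_X, ι_Y] = ι_{[X,Y]} and L_X η = 0.
variable (hC : ∀ X Y β, d (ι X (ι Y β)) + ι X (d (ι Y β)) - ι Y (d (ι X β) + ι X (d β)) = ι ⁅X, Y⁆ β)
  (hη : ∀ X, d (ι X η) + ι X (d η) = 0)

-- Equivariance of the contraction cochain: L_X commutes past each ι_Y at the cost of ι_{[X,Y]} and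
-- finally kills η.
include hC hη in
theorem lie_contractCochain (k : ℕ) (X : 𝔤) :
    (d ∘ₗ ι X + ι X ∘ₗ d).compAlternatingMap (contractCochain ι hι η k)
      = -ceLie k X (contractCochain ι hι η k) := by
  induction k with
  | zero =>
    ext x
    change d (ι X (contractCochain ι hι η 0 x)) + ι X (d (contractCochain ι hι η 0 x)) = -0
    rw [contractCochain_zero, hη, neg_zero]
  | succ k ih =>
    refine curryLeft_ext fun Y => ?_
    change _ = -(ceLie (k + 1) X (contractCochain ι hι η (k + 1))).curryLeft Y
    rw [curryLeft_ceLie, AlternatingMap.curryLeft_compAlternatingMap, curryLeft_contractCochain,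
      curryLeft_contractCochain, ← compAlternatingMap_ceLie]
    ext u
    have h := congrArg (fun c => c u) ih
    simp only [LinearMap.compAlternatingMap_apply, LinearMap.add_apply, LinearMap.comp_apply,
      AlternatingMap.neg_apply, AlternatingMap.sub_apply] at h ⊢
    rw [eq_neg_iff_add_eq_zero] at h ⊢
    rw [← hC]
    have h' := congrArg (ι Y) h
    rw [map_add, map_zero] at h'
    rw [← h']
    abel

-- Inserting X gives dι_X C_k = L_X C_k - ι_X dC_k. Equivariance turns the first term into the Lie
-- derivative of cochains and induction turns the second into δ, which is Cartan's formula for δ.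
include hC hη in
theorem d_contractCochain (hd : d η = 0) (k : ℕ) :
    d.compAlternatingMap (contractCochain ι hι η (k + 1))
      = -ceDiff k (contractCochain ι hι η k) := by
  induction k with
  | zero =>
    ext x
    change d (contractCochain ι hι η 1 x) = -0
    have h := hη (x 0)
    rw [hd, map_zero, add_zero] at h
    rw [contractCochain_succ, contractCochain_zero, h, neg_zero]
  | succ k ih =>
    refine curryLeft_ext fun X => ?_
    change _ = -(ceDiff (k + 1) (contractCochain ι hι η (k + 1))).curryLeft X
    rw [curryLeft_ceDiff, AlternatingMap.curryLeft_compAlternatingMap, curryLeft_contractCochain,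
      curryLeft_contractCochain, ← compAlternatingMap_ceDiff]
    have hL := lie_contractCochain (hι := hι) hC hη (k + 1) X
    ext u
    have h := congrArg (fun c => ι X (c u)) ih
    have hL := congrArg (fun c => c u) hL
    simp only [LinearMap.compAlternatingMap_apply, LinearMap.add_apply, LinearMap.comp_apply,
      AlternatingMap.neg_apply, AlternatingMap.sub_apply, map_neg] at h hL ⊢
    rw [h] at hL
    rw [eq_neg_iff_add_eq_zero] at hL ⊢
    rw [← hL]
    abel

/-- The cochain whose primitives are the components of arity `k + 1` that extend a given
component `F` of arity `k`. -/
def obstruction (ι : 𝔤 →ₗ[ℝ] Module.End ℝ Ω) (hι : ∀ X, ι X * ι X = 0) (η : Ω) (k : ℕ)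
    (F : 𝔤 [⋀^Fin k]→ₗ[ℝ] Ω) : 𝔤 [⋀^Fin (k + 1)]→ₗ[ℝ] Ω :=
  -ceDiff k F + (-1 : ℝ) ^ (k + 1) • contractCochain ι hι η (k + 1)

-- Since δ² = 0, the summand -δG contributes (-1)^k δC_{k+1}, where C_j is the contraction cochain
-- of arity j. The other summand contributes the opposite, by `d_contractCochain`.
include hC hη in
theorem d_obstruction_succ (hd : d η = 0) (k : ℕ) (F : 𝔤 [⋀^Fin k]→ₗ[ℝ] Ω)
    (G : 𝔤 [⋀^Fin (k + 1)]→ₗ[ℝ] Ω) (hG : d.compAlternatingMap G = obstruction ι hι η k F) :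
    d.compAlternatingMap (obstruction ι hι η (k + 1) G) = 0 := by
  have h := d_contractCochain (hι := hι) hC hη hd (k + 1)
  have h1 : d.compAlternatingMap (obstruction ι hι η (k + 1) G)
      = -d.compAlternatingMap (ceDiff (k + 1) G)
        + (-1 : ℝ) ^ (k + 2) • d.compAlternatingMap (contractCochain ι hι η (k + 2)) := by
    ext x
    simp [obstruction]
  rw [h1, compAlternatingMap_ceDiff, hG, h, obstruction, map_add, map_neg, map_smul, ceDiff_ceDiff,
    pow_succ _ (k + 1)]
  module

end CartanCalculus

/-! ### Cartan's identity on manifolds and closed functions -/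

open ContinuousAlternatingMap in
/-- Cartan's identity for 1-forms in a normed space. -/
theorem curryLeft_lieBracket_one {E : Type*} [NormedAddCommGroup E] [NormedSpace ℝ E]
    {ω₀ : E → E [⋀^Fin 1]→L[ℝ] ℝ} {v w : E → E} {p : E}
    (hω₀ : DifferentiableAt ℝ ω₀ p) (hv : DifferentiableAt ℝ v p) (hw : DifferentiableAt ℝ w p) :
    (ω₀ p).curryLeft (VectorField.lieBracket ℝ v w p)
      = (extDeriv (fun y => (ω₀ y).curryLeft (w y)) p).curryLeft (v p)
        - (extDeriv (fun y => (ω₀ y).curryLeft (v y)) p).curryLeft (w p)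
        - ((extDeriv ω₀ p).curryLeft (v p)).curryLeft (w p) := by
  -- The differential of a function is its derivative, here expanded by the Leibniz rule for ω(u).
  have key : ∀ u : E → E, DifferentiableAt ℝ u p → ∀ (a : E) (z : Fin 0 → E),
      (extDeriv (fun y => (ω₀ y).curryLeft (u y)) p).curryLeft a z
        = fderiv ℝ ω₀ p a (Matrix.vecCons (u p) z)
          + ω₀ p (Matrix.vecCons (fderiv ℝ u p a) z) := by
    intro u hu a z
    obtain ⟨B, hB, hD⟩ := hasFDerivAt_curryLeft hω₀ hu
    rw [extDeriv, hD.fderiv, curryLeft_apply_apply, alternatizeUncurryFin_apply,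
      Fin.sum_univ_succ, Finset.univ_eq_empty, Finset.sum_empty, add_zero, Fin.val_zero, pow_zero,
      one_smul]
    rw [Subsingleton.elim ((0 : Fin 1).removeNth (Matrix.vecCons a z)) z]
    change B a z + _ = _
    rw [hB]
    rfl
  ext z
  rw [ContinuousAlternatingMap.sub_apply, ContinuousAlternatingMap.sub_apply, key w hw, key v hv,
    curryLeft_apply_apply, curryLeft_apply_apply, curryLeft_apply_apply, extDeriv,
    alternatizeUncurryFin_apply, Fin.sum_univ_two]
  have h0 : (0 : Fin 2).removeNth (Matrix.vecCons (v p) (Matrix.vecCons (w p) z))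
      = Matrix.vecCons (w p) z := by
    ext i; simp [Fin.removeNth]
  have h1 : (1 : Fin 2).removeNth (Matrix.vecCons (v p) (Matrix.vecCons (w p) z))
      = Matrix.vecCons (v p) z := by
    ext i
    rw [Subsingleton.elim i 0]
    rfl
  have h2 : ω₀ p (Matrix.vecCons (VectorField.lieBracket ℝ v w p) z)
      = ω₀ p (Matrix.vecCons (fderiv ℝ w p (v p)) z)
        - ω₀ p (Matrix.vecCons (fderiv ℝ v p (w p)) z) := by
    simp only [← curryLeft_apply_apply]
    rw [VectorField.lieBracket, map_sub, ContinuousAlternatingMap.sub_apply]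
  rw [h0, h1, h2]
  simp
  ring

section Forms

variable {E : Type*} [NormedAddCommGroup E] [NormedSpace ℝ E] [FiniteDimensional ℝ E]
  {M : Type*} [TopologicalSpace M] [ChartedSpace E M] [IsManifold 𝓘(ℝ, E) ∞ M]

theorem chartRep_contract_eventuallyEq {q : ℕ} (v : VecField E M) (ω₀ : DiffForm E M (q + 1))
    (x : M) : chartRep x (contractField v ω₀) =ᶠ[𝓝 (extChartAt 𝓘(ℝ, E) x x)]
      fun y => (chartRep x ω₀ y).curryLeft (vecRep x v y) := by
  filter_upwards [extChartAt_target_mem_nhds (I := 𝓘(ℝ, E)) x] with y hy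
  exact chartRep_contractField x v ω₀ hy

theorem vecRep_self (v : VecField E M) (x : M) :
    vecRep x v (extChartAt 𝓘(ℝ, E) x x) = v x := by
  rw [vecRep, extChartAt_to_inv, mfderiv_extChartAt_self]
  rfl

theorem extD_apply_eq {q : ℕ} (η : DiffForm E M q) (x : M) :
    extD E M q η x = extDeriv (chartRep x η) (extChartAt 𝓘(ℝ, E) x x) :=
  extDerivField_eq η x

theorem extD_contract_apply {q : ℕ} (v : VecField E M) (η : DiffForm E M (q + 1)) (x : M) :
    extD E M q (contract E M q v η) x = extDeriv
      (fun y => (chartRep x η y).curryLeft (vecRep x v y)) (extChartAt 𝓘(ℝ, E) x x) := by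
  rw [extD_apply_eq]
  exact (chartRep_contract_eventuallyEq v η x).extDeriv_eq

/-- Degree one is separate: the term d ι_v ι_w of the general identity would involve a form of
degree -1. -/
theorem contract_lie_one (v w : VecField E M) (ω₀ : DiffForm E M 1) :
    contract E M 0 ⁅v, w⁆ ω₀ = contract E M 0 v (extD E M 0 (contract E M 0 w ω₀))
      - contract E M 0 w (extD E M 0 (contract E M 0 v ω₀))
      - contract E M 0 w (contract E M 1 v (extD E M 1 ω₀)) := by
  ext1 x
  have hx := mem_extChartAt_target (I := 𝓘(ℝ, E)) x
  have cartan := curryLeft_lieBracket_one (ω₀ := chartRep x ω₀) (v := vecRep x v) (w := vecRep x w)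
    (p := extChartAt 𝓘(ℝ, E) x x)
    ((contDiffAt_chartRep ω₀ x hx).differentiableAt (by simp))
    ((contDiffAt_vecRep (v.contMDiff x)).differentiableAt (by simp))
    ((contDiffAt_vecRep (w.contMDiff x)).differentiableAt (by simp))
  rw [← mlieBracket_eq_lieBracket, chartRep_self, vecRep_self, vecRep_self] at cartan
  rw [← extD_apply_eq, ← extD_contract_apply, ← extD_contract_apply] at cartan
  exact cartan

/-- Cartan's identity `[[d, ι_v], ι_w] = ι_{[v, w]}` on a manifold. -/
theorem contract_lie {q : ℕ} (v w : VecField E M) (ω₀ : DiffForm E M (q + 2)) :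
    contract E M (q + 1) ⁅v, w⁆ ω₀ = extD E M q (contract E M q v (contract E M (q + 1) w ω₀))
      + contract E M (q + 1) v (extD E M (q + 1) (contract E M (q + 1) w ω₀))
      - contract E M (q + 1) w (extD E M (q + 1) (contract E M (q + 1) v ω₀))
      - contract E M (q + 1) w (contract E M (q + 2) v (extD E M (q + 2) ω₀)) := by
  ext1 x
  have hx := mem_extChartAt_target (I := 𝓘(ℝ, E)) x
  have cartan := curryLeft_lieBracket (ω₀ := chartRep x ω₀) (v := vecRep x v) (w := vecRep x w)
    (p := extChartAt 𝓘(ℝ, E) x x)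
    ((contDiffAt_chartRep ω₀ x hx).differentiableAt (by simp))
    ((contDiffAt_vecRep (v.contMDiff x)).differentiableAt (by simp))
    ((contDiffAt_vecRep (w.contMDiff x)).differentiableAt (by simp))
  rw [← mlieBracket_eq_lieBracket, chartRep_self, vecRep_self, vecRep_self] at cartan
  rw [← extD_apply_eq, ← extD_contract_apply, ← extD_contract_apply] at cartan
  have h2 : chartRep x (contractField v (contractField w ω₀))
      =ᶠ[𝓝 (extChartAt 𝓘(ℝ, E) x x)]
        fun y => ((chartRep x ω₀ y).curryLeft (vecRep x w y)).curryLeft (vecRep x v y) := by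
    filter_upwards [extChartAt_target_mem_nhds (I := 𝓘(ℝ, E)) x] with y hy
    rw [chartRep_contractField x v _ hy, chartRep_contractField x w _ hy]
  rw [← h2.extDeriv_eq] at cartan
  have h3 : extD E M q (contract E M q v (contract E M (q + 1) w ω₀)) x
      = extDeriv (chartRep x (contractField v (contractField w ω₀)))
        (extChartAt 𝓘(ℝ, E) x x) := extD_apply_eq _ x
  rw [← h3] at cartan
  exact cartan

theorem contract_contract_self {q : ℕ} (v : VecField E M) (ω₀ : DiffForm E M (q + 2)) :
    contract E M q v (contract E M (q + 1) v ω₀) = 0 := by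
  ext1 x
  exact ContinuousAlternatingMap.curryLeft_same (𝕜 := ℝ) (E := E) (F := ℝ) (ω₀ x) (v x)

/-- The value of a 0-form at a point. -/
def evalZero (x : M) : DiffForm E M 0 →ₗ[ℝ] ℝ where
  toFun η := DFunLike.coe (F := E [⋀^Fin 0]→L[ℝ] ℝ) (η x) 0
  map_add' _ _ := rfl
  map_smul' _ _ := rfl

theorem evalZero_chartRep (η : DiffForm E M 0) (x : M) (y : E) (u : Fin 0 → E) :
    chartRep x η y u = evalZero ((extChartAt 𝓘(ℝ, E) x).symm y) η := by
  rw [Subsingleton.elim u 0]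
  exact congrArg (DFunLike.coe (F := E [⋀^Fin 0]→L[ℝ] ℝ)
    (η ((extChartAt 𝓘(ℝ, E) x).symm y))) (Subsingleton.elim _ _)

theorem zeroForm_ext {η η' : DiffForm E M 0} (h : ∀ x, evalZero x η = evalZero x η') : η = η' := by
  ext1 x
  refine ContinuousAlternatingMap.ext (M := E) (N := ℝ) fun u => ?_
  rw [Subsingleton.elim u 0]
  exact h x

/-- Closed 0-forms are locally constant. -/
theorem evalZero_eq_of_closed [ConnectedSpace M] (η : DiffForm E M 0) (hη : extD E M 0 η = 0)
    (x x' : M) : evalZero x η = evalZero x' η := by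
  have hloc : IsLocallyConstant fun x => evalZero x η := by
    rw [IsLocallyConstant.iff_eventually_eq]
    intro x₀
    obtain ⟨r, hr, hball⟩ := Metric.mem_nhds_iff.1 (extChartAt_target_mem_nhds (I := 𝓘(ℝ, E)) x₀)
    have hdiff : ∀ y ∈ Metric.ball (extChartAt 𝓘(ℝ, E) x₀ x₀) r,
        DifferentiableAt ℝ (chartRep x₀ η) y := fun y hy =>
      (contDiffAt_chartRep η x₀ (hball hy)).differentiableAt (by simp)
    -- The alternatization that defines d has a single summand on 0-forms, so closedness says that
    -- the derivative in the chart vanishes.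
    have hzero : Set.EqOn (fderiv ℝ (chartRep x₀ η)) 0
        (Metric.ball (extChartAt 𝓘(ℝ, E) x₀ x₀) r) := by
      intro y hy
      have h1 : extDeriv (chartRep x₀ η) y = 0 := by
        rw [← chartRep_extDerivField η x₀ (hball hy)]
        have h2 : extDerivField η = fun x => (0 : CotangentPower E M 1 x) := by
          funext x
          exact congrArg (fun η : DiffForm E M 1 => η x) hη
        rw [h2]
        rfl
      ext a u
      have h3 := congrArg (fun g => g (fun _ : Fin 1 => a)) h1
      rw [extDeriv, ContinuousAlternatingMap.alternatizeUncurryFin_apply, Fin.sum_univ_succ,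
        Finset.univ_eq_empty, Finset.sum_empty, add_zero, Fin.val_zero, pow_zero, one_smul] at h3
      rw [Subsingleton.elim u ((0 : Fin 1).removeNth fun _ => a)]
      exact h3
    have hconst : ∀ y ∈ Metric.ball (extChartAt 𝓘(ℝ, E) x₀ x₀) r,
        chartRep x₀ η y = chartRep x₀ η (extChartAt 𝓘(ℝ, E) x₀ x₀) := fun y hy =>
      Metric.isOpen_ball.is_const_of_fderiv_eq_zero (convex_ball _ _).isPreconnected
        (fun z hz => (hdiff z hz).differentiableWithinAt) hzero hy (Metric.mem_ball_self hr)
    have hpre : ∀ᶠ x in 𝓝 x₀, extChartAt 𝓘(ℝ, E) x₀ x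
        ∈ Metric.ball (extChartAt 𝓘(ℝ, E) x₀ x₀) r :=
      (continuousAt_extChartAt x₀).preimage_mem_nhds (Metric.ball_mem_nhds _ hr)
    filter_upwards [hpre, extChartAt_source_mem_nhds (I := 𝓘(ℝ, E)) x₀] with x hx hsrc
    have h := congrArg (fun g => g 0) (hconst _ hx)
    simp only [evalZero_chartRep] at h
    rwa [(extChartAt 𝓘(ℝ, E) x₀).left_inv hsrc, extChartAt_to_inv] at h
  exact hloc.apply_eq_of_preconnectedSpace x x'

variable (E M) in
/-- Constant functions as 0-forms. -/
def constForm : ℝ →ₗ[ℝ] DiffForm E M 0 where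
  toFun c := ⟨fun _ => ContinuousAlternatingMap.constOfIsEmpty ℝ E (Fin 0) c, fun _ =>
    contMDiffAt_form_iff.2
      (contDiffAt_const (c := ContinuousAlternatingMap.constOfIsEmpty ℝ E (Fin 0) c))⟩
  map_add' _ _ := rfl
  map_smul' _ _ := rfl

theorem evalZero_constForm (c : ℝ) (x : M) : evalZero x (constForm E M c) = c := rfl

theorem extD_constForm (c : ℝ) : extD E M 0 (constForm E M c) = 0 := by
  ext1 x
  rw [extD_apply_eq]
  change extDeriv (fun _ : E => ContinuousAlternatingMap.constOfIsEmpty ℝ E (Fin 0) c) _ = 0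
  rw [extDeriv, fderiv_fun_const]
  exact map_zero (ContinuousAlternatingMap.alternatizeUncurryFinCLM ℝ E ℝ (n := 0))

end Forms

/-- A primitive that depends linearly on the exact element. Composing a cochain with `s` therefore
yields a cochain again, which a pointwise choice of primitives would not. -/
theorem _root_.LinearMap.exists_section_on_range {K V W : Type*} [DivisionRing K] [AddCommGroup V]
    [Module K V] [AddCommGroup W] [Module K W] (f : V →ₗ[K] W) :
    ∃ s : W →ₗ[K] V, ∀ α, f (s (f α)) = f α := by
  obtain ⟨g, hg⟩ := LinearMap.exists_rightInverse_of_surjective f.rangeRestrict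
    (LinearMap.range_rangeRestrict _)
  obtain ⟨s, hs⟩ := LinearMap.exists_extend g
  refine ⟨s, fun α => ?_⟩
  have h1 := LinearMap.congr_fun hs (f.rangeRestrict α)
  have h2 := congrArg Subtype.val (LinearMap.congr_fun hg (f.rangeRestrict α))
  change s (f α) = _ at h1
  rw [h1]
  exact h2

/-! ### Forms of all degrees at once and the action on them -/

section TotalForms

variable (E : Type*) [NormedAddCommGroup E] [NormedSpace ℝ E] [FiniteDimensional ℝ E]
  (M : Type*) [TopologicalSpace M] [ChartedSpace E M] [IsManifold 𝓘(ℝ, E) ∞ M]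

/-- Families of forms, one in every degree. -/
abbrev TotalForm : Type _ := ∀ q : ℕ, DiffForm E M q

/-- The exterior derivative on families of forms. -/
def totalD : TotalForm E M →ₗ[ℝ] TotalForm E M :=
  LinearMap.pi fun
    | 0 => 0
    | q + 1 => extD E M q ∘ₗ LinearMap.proj q

/-- The contraction of families of forms. -/
def totalContract : VecField E M →ₗ[ℝ] Module.End ℝ (TotalForm E M) :=
  LinearMap.mk₂ ℝ (fun v η q => contract E M q v (η (q + 1)))
    (fun v w η => by ext1 q; simp) (fun c v η => by ext1 q; simp)
    (fun v η η' => by ext1 q; simp) (fun c v η => by ext1 q; simp)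

variable {E M}

instance : AddCommGroup (TotalForm E M) := Pi.addCommGroup

instance : AddCommMonoid (TotalForm E M) := AddCommGroup.toAddCommMonoid

instance : Module ℝ (TotalForm E M) := Pi.module _ _ _

theorem totalD_zero (η : TotalForm E M) : totalD E M η 0 = 0 := rfl

theorem totalD_succ (η : TotalForm E M) (q : ℕ) : totalD E M η (q + 1) = extD E M q (η q) := rfl

theorem totalContract_apply (v : VecField E M) (η : TotalForm E M) (q : ℕ) :
    totalContract E M v η q = contract E M q v (η (q + 1)) := rfl

theorem totalContract_mul_self (v : VecField E M) :
    totalContract E M v * totalContract E M v = 0 := by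
  ext1 η
  funext q
  exact contract_contract_self v _

/-- Gathering all degrees turns contractions into endomorphisms of one space, as the abstract
calculus requires. Degree 0 of the identity is the 1-form case of Cartan's identity, because d has
no component there. -/
theorem totalD_totalContract_lie (v w : VecField E M) (η : TotalForm E M) :
    totalD E M (totalContract E M v (totalContract E M w η))
      + totalContract E M v (totalD E M (totalContract E M w η))
      - totalContract E M w (totalD E M (totalContract E M v η) + totalContract E M v (totalD E M η))
      = totalContract E M ⁅v, w⁆ η := by
  rw [map_add, ← sub_sub]
  funext q
  cases q with
  | zero =>
    refine Eq.trans ?_ (contract_lie_one v w (η 1)).symm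
    simp only [Pi.add_apply, Pi.sub_apply, totalD_zero, zero_add]
    rfl
  | succ q => exact (contract_lie v w (η (q + 2))).symm

theorem totalD_single (q : ℕ) (η : DiffForm E M q) :
    totalD E M (Pi.single q η) = Pi.single (q + 1) (extD E M q η) := by
  funext r
  cases r with
  | zero => rw [totalD_zero, Pi.single_eq_of_ne (by omega)]
  | succ r =>
    rw [totalD_succ]
    rcases eq_or_ne r q with rfl | h
    · rw [Pi.single_eq_same, Pi.single_eq_same]
    · rw [Pi.single_eq_of_ne h, Pi.single_eq_of_ne (by omega), map_zero]

theorem totalContract_single (v : VecField E M) (q : ℕ) (η : DiffForm E M (q + 1)) :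
    totalContract E M v (Pi.single (q + 1) η) = Pi.single q (contract E M q v η) := by
  funext r
  rw [totalContract_apply]
  rcases eq_or_ne r q with rfl | h
  · rw [Pi.single_eq_same, Pi.single_eq_same]
  · rw [Pi.single_eq_of_ne h, Pi.single_eq_of_ne (by omega), map_zero]

variable {𝔤 : Type*} [LieRing 𝔤] [LieAlgebra ℝ 𝔤]

/-- Contraction with the vector fields of an infinitesimal action. -/
def actionContract (ζ : 𝔤 →ₗ⁅ℝ⁆ VecField E M) : 𝔤 →ₗ[ℝ] Module.End ℝ (TotalForm E M) :=
  totalContract E M ∘ₗ (ζ : 𝔤 →ₗ[ℝ] VecField E M)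

theorem actionContract_apply (ζ : 𝔤 →ₗ⁅ℝ⁆ VecField E M) (X : 𝔤) :
    actionContract ζ X = totalContract E M (ζ X) := rfl

theorem actionContract_mul_self (ζ : 𝔤 →ₗ⁅ℝ⁆ VecField E M) (X : 𝔤) :
    actionContract ζ X * actionContract ζ X = 0 := totalContract_mul_self _

theorem totalD_actionContract_lie (ζ : 𝔤 →ₗ⁅ℝ⁆ VecField E M) (X Y : 𝔤) (η : TotalForm E M) :
    totalD E M (actionContract ζ X (actionContract ζ Y η))
      + actionContract ζ X (totalD E M (actionContract ζ Y η))
      - actionContract ζ Y (totalD E M (actionContract ζ X η) + actionContract ζ X (totalD E M η))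
      = actionContract ζ ⁅X, Y⁆ η := by
  simp only [actionContract_apply]
  rw [totalD_totalContract_lie, LieHom.map_lie]

/-- `(X₁, …, X_k) ↦ ι_{ζ(X₁)} … ι_{ζ(X_k)} ω` for a form `ω`. -/
def actionCochain {N : ℕ} (ζ : 𝔤 →ₗ⁅ℝ⁆ VecField E M) (ω₀ : DiffForm E M N) (k : ℕ) :
    𝔤 [⋀^Fin k]→ₗ[ℝ] TotalForm E M :=
  contractCochain (actionContract ζ) (actionContract_mul_self ζ) (Pi.single N ω₀) k

theorem actionCochain_eq_zero {N : ℕ} (ζ : 𝔤 →ₗ⁅ℝ⁆ VecField E M) (ω₀ : DiffForm E M N) (k : ℕ)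
    (x : Fin k → 𝔤) (q : ℕ) (h : q + k ≠ N) : actionCochain ζ ω₀ k x q = 0 := by
  induction k generalizing q with
  | zero =>
    rw [actionCochain, contractCochain_zero]
    exact Pi.single_eq_of_ne h _
  | succ k ih =>
    rw [actionCochain, contractCochain_succ, actionContract_apply, totalContract_apply]
    have := ih (fun i => x i.succ) (q + 1) (by omega)
    rw [actionCochain] at this
    rw [this, map_zero]

/-- The brackets use ι_{v_k} ⋯ ι_{v_1} and the cochains the opposite order; reversing k
anticommuting contractions costs (-1)^(k(k-1)/2). -/
theorem iterContract_eq {N : ℕ} (ζ : 𝔤 →ₗ⁅ℝ⁆ VecField E M) (ω₀ : DiffForm E M N) (q k : ℕ)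
    (h : N = q + k) (x : Fin k → 𝔤) :
    iterContract E M q k (fun i => ζ (x i)) (h ▸ ω₀)
      = (-1 : ℝ) ^ (k * (k - 1) / 2) • actionCochain ζ ω₀ k x q := by
  subst h
  induction k with
  | zero =>
    rw [iterContract_zero, actionCochain, contractCochain_zero]
    change ω₀ = (-1 : ℝ) ^ 0 • (Pi.single q ω₀ : TotalForm E M) q
    rw [pow_zero, one_smul, Pi.single_eq_same]
  | succ k ih =>
    have h1 := ih (fun i => x i.succ) (contract E M (q + k) (ζ (x 0)) ω₀)
    rw [actionCochain, ← totalContract_single, ← actionContract_apply,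
      contractCochain_contract, Pi.smul_apply, smul_smul, ← pow_add] at h1
    -- Moving the first contraction outward past k others adds k to the exponent, the step between
    -- consecutive triangular numbers.
    have h2 : k * (k - 1) / 2 + k = (k + 1) * (k + 1 - 1) / 2 := by
      have h3 := Nat.triangle_succ k
      rw [h3, Nat.mul_comm]
    rw [h2] at h1
    rw [actionCochain, contractCochain_succ]
    exact h1

theorem evalZero_iterContract {N : ℕ} (k : ℕ) (h : N = 0 + k) (η : DiffForm E M N)
    (v : Fin k → VecField E M) (p : M) :
    evalZero p (iterContract E M 0 k v (h ▸ η)) = DFunLike.coe (F := E [⋀^Fin N]→L[ℝ] ℝ) (η p)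
      (fun i => v (Fin.cast (h.trans (Nat.zero_add k)) i) p) := by
  subst h
  induction k with
  | zero =>
    exact congrArg (DFunLike.coe (F := E [⋀^Fin 0]→L[ℝ] ℝ) (η p)) (Subsingleton.elim _ _)
  | succ k ih =>
    refine (ih (fun i => v i.succ) (contract E M (0 + k) (v 0) η)).trans ?_
    refine congrArg (DFunLike.coe (F := E [⋀^Fin (0 + k + 1)]→L[ℝ] ℝ) (η p)) ?_
    funext i
    refine Fin.cases ?_ (fun i => ?_) i <;> rfl

theorem evalZero_actionCochain {N : ℕ} (ζ : 𝔤 →ₗ⁅ℝ⁆ VecField E M) (ω₀ : DiffForm E M N)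
    (x : Fin N → 𝔤) (p : M) :
    evalZero p (actionCochain ζ ω₀ N x 0) = (-1 : ℝ) ^ (N * (N - 1) / 2) *
      DFunLike.coe (F := E [⋀^Fin N]→L[ℝ] ℝ) (ω₀ p) (fun i => ζ (x i) p) := by
  have h1 := iterContract_eq ζ ω₀ 0 N (Nat.zero_add N).symm x
  have h2 := evalZero_iterContract N (Nat.zero_add N).symm ω₀ (fun i => ζ (x i)) p
  rw [h1, map_smul, smul_eq_mul] at h2
  have h3 : ((-1 : ℝ) ^ (N * (N - 1) / 2)) * (-1 : ℝ) ^ (N * (N - 1) / 2) = 1 := by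
    rw [← mul_pow]; simp
  have h4 := congrArg (fun r => (-1 : ℝ) ^ (N * (N - 1) / 2) * r) h2
  simp only [← mul_assoc, h3, one_mul] at h4
  exact h4

/-- Identifies c_p with the contraction term of the last equation of the tower, signs included. -/
theorem smul_evalZero_actionCochain {m : ℕ} (ζ : 𝔤 →ₗ⁅ℝ⁆ VecField E M)
    (ω₀ : DiffForm E M (m + 2)) (x : Fin (m + 2) → 𝔤) (p : M) :
    (-1 : ℝ) ^ (m + 2) * evalZero p (actionCochain ζ ω₀ (m + 2) x 0)
      = momentCochain ω₀ ζ p x := by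
  rw [evalZero_actionCochain, momentCochain, AlternatingMap.smul_apply, smul_eq_mul, ← mul_assoc]
  congr 1
  rw [show (m + 2) * (m + 2 - 1) = (m + 1) * (m + 2) from Nat.mul_comm _ _]
  ring

theorem exists_extD_eq (q : ℕ) [Subsingleton (DeRhamCohomology E M (q + 1))]
    (η : DiffForm E M (q + 1)) (hη : extD E M (q + 1) η = 0) : ∃ α, extD E M q α = η := by
  have h := (Submodule.Quotient.mk_eq_zero ((exactForms E M (q + 1)).submoduleOf
    (closedForms E M (q + 1))) (x := ⟨η, hη⟩)).1 (Subsingleton.elim _ _)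
  exact h

/-- The obstruction cochain of an infinitesimal action and a form. -/
def actionObstruction {N : ℕ} (ζ : 𝔤 →ₗ⁅ℝ⁆ VecField E M) (ω₀ : DiffForm E M N) (k : ℕ)
    (F : 𝔤 [⋀^Fin k]→ₗ[ℝ] TotalForm E M) : 𝔤 [⋀^Fin (k + 1)]→ₗ[ℝ] TotalForm E M :=
  obstruction (actionContract ζ) (actionContract_mul_self ζ) (Pi.single N ω₀) k F

theorem actionObstruction_apply {N : ℕ} (ζ : 𝔤 →ₗ⁅ℝ⁆ VecField E M) (ω₀ : DiffForm E M N) (k : ℕ)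
    (F : 𝔤 [⋀^Fin k]→ₗ[ℝ] TotalForm E M) (x : Fin (k + 1) → 𝔤) :
    actionObstruction ζ ω₀ k F x
      = -ceDiff k F x + (-1 : ℝ) ^ (k + 1) • actionCochain ζ ω₀ (k + 1) x := rfl

/-- The components of arity `k` of a homotopy co-moment map, built from a choice of primitives. -/
def componentAux {N : ℕ} (s : ∀ q, DiffForm E M (q + 1) →ₗ[ℝ] DiffForm E M q)
    (ζ : 𝔤 →ₗ⁅ℝ⁆ VecField E M) (ω₀ : DiffForm E M N) :
    ∀ k : ℕ, 𝔤 [⋀^Fin k]→ₗ[ℝ] TotalForm E M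
  | 0 => 0
  -- The chosen primitive is applied in every degree, whether or not the obstruction is exact; that
  -- it is a primitive is shown only in the range where it is used.
  | k + 1 => (LinearMap.pi fun q => s q ∘ₗ LinearMap.proj (q + 1)).compAlternatingMap
      (actionObstruction ζ ω₀ k
        (componentAux s ζ ω₀ k))

theorem actionObstruction_eq_zero {m : ℕ} (ζ : 𝔤 →ₗ⁅ℝ⁆ VecField E M) (ω₀ : DiffForm E M (m + 2)) (k : ℕ)
    (F : 𝔤 [⋀^Fin k]→ₗ[ℝ] TotalForm E M) (hF : ∀ x q, q + k ≠ m + 1 → F x q = 0)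
    (x : Fin (k + 1) → 𝔤) (q : ℕ) (h : q + k ≠ m + 1) :
    actionObstruction ζ ω₀ k F x q
      = 0 := by
  -- Projection to one form degree commutes with δ, so δF vanishes in every degree where F does.
  have h1 : (LinearMap.proj (R := ℝ) (φ := fun q => DiffForm E M q) q).compAlternatingMap F
      = 0 := by
    ext1 y
    exact hF y q h
  have h2 := compAlternatingMap_ceDiff (LinearMap.proj (R := ℝ) (φ := fun q => DiffForm E M q) q) k F
  rw [h1, map_zero] at h2
  have h3 : ceDiff k F x q = 0 := congrArg (fun c => c x) h2
  rw [actionObstruction_apply, Pi.add_apply, Pi.neg_apply, Pi.smul_apply, h3,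
    actionCochain_eq_zero ζ ω₀ (k + 1) x q (by omega), neg_zero, zero_add]
  exact smul_zero (A := DiffForm E M q) ((-1 : ℝ) ^ (k + 1))

theorem componentAux_eq_zero {m : ℕ} (s : ∀ q, DiffForm E M (q + 1) →ₗ[ℝ] DiffForm E M q)
    (ζ : 𝔤 →ₗ⁅ℝ⁆ VecField E M) (ω₀ : DiffForm E M (m + 2)) (k : ℕ) (x : Fin k → 𝔤) (q : ℕ)
    (h : q + k ≠ m + 1) : componentAux s ζ ω₀ k x q = 0 := by
  induction k generalizing q with
  | zero => rfl
  | succ k ih =>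
    change s q (actionObstruction ζ ω₀ k (componentAux s ζ ω₀ k) x (q + 1)) = 0
    rw [actionObstruction_eq_zero ζ ω₀ k _ ih x (q + 1) (by omega), (s q).map_zero]

/-! ### Solving the tower of equations -/

section Existence

variable {m : ℕ} {ω₀ : DiffForm E M (m + 2)} {ζ : 𝔤 →ₗ⁅ℝ⁆ VecField E M}

theorem totalD_single_eq_zero (hω : extD E M (m + 2) ω₀ = 0) :
    totalD E M (Pi.single (m + 2) ω₀) = 0 := by
  rw [totalD_single, hω, Pi.single_zero]

/-- Weak Hamiltonicity gives ι_X ω = -dα, so both terms of L_X ω vanish: the first by d² = 0, the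
second because ω is closed. -/
theorem totalLie_single_eq_zero (hω : extD E M (m + 2) ω₀ = 0) (hζ : IsWeaklyHamiltonian ω₀ ζ)
    (X : 𝔤) : totalD E M (actionContract ζ X (Pi.single (m + 2) ω₀))
      + actionContract ζ X (totalD E M (Pi.single (m + 2) ω₀)) = 0 := by
  obtain ⟨j, hj⟩ := hζ
  have h : extD E M m (j X).1.2 = -contract E M (m + 1) (j X).1.1 ω₀ := (j X).2
  rw [hj] at h
  replace h := neg_eq_iff_eq_neg.1 h.symm
  rw [totalD_single_eq_zero hω, (actionContract ζ X).map_zero, add_zero, actionContract_apply,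
    totalContract_single, totalD_single, h, (extD E M (m + 1)).map_neg, extD_extD, neg_zero,
    Pi.single_zero]

theorem extD_actionObstruction (hω : extD E M (m + 2) ω₀ = 0) (hζ : IsWeaklyHamiltonian ω₀ ζ)
    (k : ℕ) (F : 𝔤 [⋀^Fin k]→ₗ[ℝ] TotalForm E M) (G : 𝔤 [⋀^Fin (k + 1)]→ₗ[ℝ] TotalForm E M)
    (hG : ∀ x, totalD E M (G x) = actionObstruction ζ ω₀ k F x) (x : Fin (k + 2) → 𝔤) (q : ℕ) :
    extD E M q (actionObstruction ζ ω₀ (k + 1) G x q) = 0 := by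
  have h1 : (totalD E M).compAlternatingMap (actionObstruction ζ ω₀ (k + 1) G) = 0 :=
    d_obstruction_succ (ι := actionContract ζ) (d := totalD E M) (η := Pi.single (m + 2) ω₀)
      (hι := actionContract_mul_self ζ) (totalD_actionContract_lie ζ)
      (totalLie_single_eq_zero hω hζ) (totalD_single_eq_zero hω) k F G (AlternatingMap.ext hG)
  have h2 := congrArg (fun c => c x) h1
  exact congrFun h2 (q + 1)

theorem componentAux_succ_apply (s : ∀ q, DiffForm E M (q + 1) →ₗ[ℝ] DiffForm E M q) (k : ℕ)
    (x : Fin (k + 1) → 𝔤) (q : ℕ) : componentAux s ζ ω₀ (k + 1) x q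
      = s q (actionObstruction ζ ω₀ k (componentAux s ζ ω₀ k) x (q + 1)) := rfl

theorem totalD_componentAux_of_ne (s : ∀ q, DiffForm E M (q + 1) →ₗ[ℝ] DiffForm E M q) (k : ℕ)
    (x : Fin (k + 1) → 𝔤) (q : ℕ) (hq : q + k ≠ m + 1) :
    totalD E M (componentAux s ζ ω₀ (k + 1) x) q
      = actionObstruction ζ ω₀ k (componentAux s ζ ω₀ k) x q := by
  rw [actionObstruction_eq_zero ζ ω₀ k _ (componentAux_eq_zero s ζ ω₀ k) x q hq]
  cases q with
  | zero => rfl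
  | succ q => rw [totalD_succ, componentAux_eq_zero s ζ ω₀ (k + 1) x q (by omega), (extD E M q).map_zero]

theorem actionObstruction_zero_apply (F : 𝔤 [⋀^Fin 0]→ₗ[ℝ] TotalForm E M) (x : Fin 1 → 𝔤) :
    actionObstruction ζ ω₀ 0 F x (m + 1) = -contract E M (m + 1) (ζ (x 0)) ω₀ := by
  rw [actionObstruction_apply, actionCochain, contractCochain_succ, contractCochain_zero,
    actionContract_apply, totalContract_single]
  change (-(0 : TotalForm E M) + (-1 : ℝ) ^ (0 + 1) • _) (m + 1) = _
  rw [Pi.add_apply, Pi.smul_apply, Pi.single_eq_same, neg_zero, Pi.zero_apply, zero_add]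
  module

/-- The given weak moment map is used only to know that ι_X ω is exact; the primitive itself is the
one chosen by `s`. -/
theorem totalD_componentAux_one (s : ∀ q, DiffForm E M (q + 1) →ₗ[ℝ] DiffForm E M q)
    (hs : ∀ q α, extD E M q (s q (extD E M q α)) = extD E M q α) (hζ : IsWeaklyHamiltonian ω₀ ζ)
    (x : Fin 1 → 𝔤) : totalD E M (componentAux s ζ ω₀ 1 x)
      = actionObstruction ζ ω₀ 0 (componentAux s ζ ω₀ 0) x := by
  funext q
  rcases eq_or_ne q (m + 1) with rfl | hq
  · obtain ⟨j, hj⟩ := hζ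
    have h2 : extD E M m (j (x 0)).1.2 = -contract E M (m + 1) (j (x 0)).1.1 ω₀ := (j (x 0)).2
    rw [hj] at h2
    rw [totalD_succ, componentAux_succ_apply, actionObstruction_zero_apply, ← h2, hs]
  · exact totalD_componentAux_of_ne s 0 x q hq

theorem totalD_componentAux (s : ∀ q, DiffForm E M (q + 1) →ₗ[ℝ] DiffForm E M q)
    (hs : ∀ q α, extD E M q (s q (extD E M q α)) = extD E M q α)
    (hω : extD E M (m + 2) ω₀ = 0) (hζ : IsWeaklyHamiltonian ω₀ ζ)
    (hH : ∀ k : ℕ, 1 ≤ k → k ≤ m → Subsingleton (DeRhamCohomology E M k)) (k : ℕ) (hk : k ≤ m)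
    (x : Fin (k + 1) → 𝔤) : totalD E M (componentAux s ζ ω₀ (k + 1) x)
      = actionObstruction ζ ω₀ k (componentAux s ζ ω₀ k) x := by
  induction k with
  | zero => exact totalD_componentAux_one s hs hζ x
  | succ k ih =>
    have hcl := extD_actionObstruction hω hζ k (componentAux s ζ ω₀ k)
      (componentAux s ζ ω₀ (k + 1)) (ih (by omega)) x
    funext q
    by_cases hq : q + (k + 1) = m + 1
    -- Here k + 1 ≤ m forces 1 ≤ q ≤ m, exactly the range where cohomology vanishes.
    · obtain ⟨r, rfl⟩ : ∃ r, q = r + 1 := ⟨q - 1, by omega⟩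
      have := hH (r + 1) (by omega) (by omega)
      obtain ⟨α, hα⟩ := exists_extD_eq r _ (hcl (r + 1))
      rw [totalD_succ, componentAux_succ_apply, ← hα, hs]
    · exact totalD_componentAux_of_ne s (k + 1) x q hq

variable (E M) in
/-- Constant functions as families of forms. -/
def totalConst : ℝ →ₗ[ℝ] TotalForm E M :=
  LinearMap.single ℝ (fun q => DiffForm E M q) 0 ∘ₗ constForm E M

theorem totalConst_zero (r : ℝ) : totalConst E M r 0 = constForm E M r :=
  Pi.single_eq_same (M := fun q => DiffForm E M q) 0 _

theorem totalConst_of_ne (r : ℝ) (q : ℕ) (hq : q ≠ 0) : totalConst E M r q = 0 :=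
  Pi.single_eq_of_ne (M := fun q => DiffForm E M q) hq _

theorem totalD_totalConst (r : ℝ) : totalD E M (totalConst E M r) = 0 := by
  change totalD E M (Pi.single 0 (constForm E M r)) = 0
  rw [totalD_single, extD_constForm, Pi.single_zero]

/-- The value at `p` of the component of degree `0`. -/
def evalTotal (p : M) : TotalForm E M →ₗ[ℝ] ℝ := evalZero p ∘ₗ LinearMap.proj 0

theorem evalTotal_apply (p : M) (η : TotalForm E M) : evalTotal p η = evalZero p (η 0) := rfl

theorem evalTotal_totalConst (p : M) (r : ℝ) : evalTotal p (totalConst E M r) = r := by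
  rw [evalTotal_apply, totalConst_zero, evalZero_constForm]

/-- Only the degree 0 component can be nonzero. It is a closed function, hence determined by its
value at p, and there the two summands are -c_p and c_p. -/
theorem actionObstruction_top_eq_zero [ConnectedSpace M] (p : M)
    (T : 𝔤 [⋀^Fin (m + 1)]→ₗ[ℝ] TotalForm E M) (hdeg : ∀ x q, q + (m + 1) ≠ m + 1 → T x q = 0)
    (hcl : ∀ x q, extD E M q (actionObstruction ζ ω₀ (m + 1) T x q) = 0)
    (hT : ceD 𝔤 (m + 1) ((evalTotal p).compAlternatingMap T) = momentCochain ω₀ ζ p)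
    (x : Fin (m + 2) → 𝔤) : actionObstruction ζ ω₀ (m + 1) T x = 0 := by
  funext q
  rcases Nat.eq_zero_or_pos q with rfl | hq
  · refine zeroForm_ext fun y => ?_
    rw [evalZero_eq_of_closed _ (hcl x 0) y p, ← evalTotal_apply, actionObstruction_apply]
    have h1 : evalTotal p (ceDiff (m + 1) T x) = momentCochain ω₀ ζ p x := by
      have h := congrArg (fun c => c x) (compAlternatingMap_ceDiff (evalTotal p) (m + 1) T)
      rw [ceDiff_eq_ceD, hT] at h
      exact h
    have h2 := smul_evalZero_actionCochain ζ ω₀ x p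
    rw [map_add, map_neg, map_smul, h1, ← h2]
    exact neg_add_cancel _
  · exact actionObstruction_eq_zero ζ ω₀ (m + 1) T hdeg x q (by omega)

set_option maxHeartbeats 1000000 in
/-- The components of a homotopy co-moment map. -/
theorem exists_components [ConnectedSpace M] (hω : extD E M (m + 2) ω₀ = 0)
    (hζ : IsWeaklyHamiltonian ω₀ ζ)
    (hH : ∀ k : ℕ, 1 ≤ k → k ≤ m → Subsingleton (DeRhamCohomology E M k))
    (p : M) (b : 𝔤 [⋀^Fin (m + 1)]→ₗ[ℝ] ℝ) (hb : ceD 𝔤 (m + 1) b = momentCochain ω₀ ζ p) :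
    ∃ F : ∀ k, 𝔤 [⋀^Fin k]→ₗ[ℝ] TotalForm E M,
      (∀ k x q, q + k ≠ m + 1 → F k x q = 0) ∧
      ∀ k x, totalD E M (F (k + 1) x) = actionObstruction ζ ω₀ k (F k) x := by
  choose s hs using fun q => (extD E M q).exists_section_on_range
  -- Only the degrees and differentials of the components matter from here on, so their construction
  -- is forgotten.
  obtain ⟨G, hG⟩ : ∃ G, G = componentAux s ζ ω₀ := ⟨_, rfl⟩
  have hG0 : ∀ k x q, q + k ≠ m + 1 → G k x q = 0 := by
    subst hG
    exact componentAux_eq_zero s ζ ω₀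
  have hGd : ∀ k, k ≤ m → ∀ x, totalD E M (G (k + 1) x) = actionObstruction ζ ω₀ k (G k) x := by
    subst hG
    exact totalD_componentAux s hs hω hζ hH
  clear hG
  -- Constants correct the function-valued component so that its value at p becomes b, without
  -- changing its differential.
  obtain ⟨T, hT⟩ : ∃ T : 𝔤 [⋀^Fin (m + 1)]→ₗ[ℝ] TotalForm E M, ∀ x, T x = G (m + 1) x
      + totalConst E M (b x - evalTotal p (G (m + 1) x)) :=
    ⟨G (m + 1) + (totalConst E M).compAlternatingMap
      (b - (evalTotal p).compAlternatingMap (G (m + 1))), fun x => rfl⟩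
  have hTb : (evalTotal p).compAlternatingMap T = b := by
    ext x
    rw [LinearMap.compAlternatingMap_apply, hT, (evalTotal p).map_add, evalTotal_totalConst, add_sub_cancel]
  have hdT : ∀ x, totalD E M (T x) = actionObstruction ζ ω₀ m (G m) x := fun x => by
    rw [hT, (totalD E M).map_add, totalD_totalConst, add_zero, hGd m le_rfl]
  have hdeg : ∀ x q, q + (m + 1) ≠ m + 1 → T x q = 0 := fun x q hq => by
    rw [hT, Pi.add_apply, hG0 _ _ _ hq, totalConst_of_ne _ _ (by omega), add_zero]
  have hobs := actionObstruction_top_eq_zero p T hdeg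
    (extD_actionObstruction hω hζ m (G m) T hdT) (by rw [hTb, hb])
  have hF : ∀ k x q, q + k ≠ m + 1 → Function.update G (m + 1) T k x q = 0 := by
    intro k x q h
    rcases eq_or_ne k (m + 1) with rfl | hk
    · rw [Function.update_self]
      exact hdeg x q h
    · rw [Function.update_of_ne hk]
      exact hG0 k x q h
  refine ⟨Function.update G (m + 1) T, hF, fun k x => ?_⟩
  rcases lt_trichotomy k (m + 1) with hk | rfl | hk
  · rw [Function.update_of_ne hk.ne]
    rcases (Nat.lt_succ_iff.1 hk).eq_or_lt with rfl | hk'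
    · rw [Function.update_self, hdT]
    · rw [Function.update_of_ne (by omega)]
      exact hGd k hk'.le x
  -- Beyond arity m + 1 no form degree is available, so the next component is zero.
  all_goals
    rw [show Function.update G (m + 1) T (_ + 1) x = 0 from by
      funext q; exact hF _ x q (by omega), (totalD E M).map_zero]
  · rw [Function.update_self, hobs]
  · funext q
    exact (actionObstruction_eq_zero ζ ω₀ k _ (hF k) x q (by omega)).symm

end Existence

end TotalForms

/-! ### Unshuffles with a first block of length two -/

section Unshuffles

theorem perm_eq_one_of_strictMono {N : ℕ} {σ : Equiv.Perm (Fin N)} (h : StrictMono σ) : σ = 1 := by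
  have := (StrictMono.range_inj h (strictMono_id (α := Fin N))).1 (by simp)
  ext i
  rw [this]
  rfl

theorem koszulSign_zero {N : ℕ} (σ : Equiv.Perm (Fin N)) : koszulSign σ 0 = 1 := by
  simp [koszulSign]

variable {n : ℕ}

/-- The unshuffle that moves the entries `i` and `j + 1`, where `i ≤ j`, to the front. -/
def pairPerm (i j : Fin (n + 1)) : Equiv.Perm (Fin (n + 2)) :=
  i.castSucc.cycleRange⁻¹ * Equiv.Perm.decomposeFin.symm (0, j.cycleRange⁻¹)

theorem pairPerm_zero (i j : Fin (n + 1)) : pairPerm i j 0 = i.castSucc := by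
  rw [pairPerm, Equiv.Perm.mul_apply, Equiv.Perm.decomposeFin_symm_apply_zero]
  exact Fin.cycleRange_symm_zero _

theorem pairPerm_succ (i j t : Fin (n + 1)) :
    pairPerm i j t.succ = i.castSucc.succAbove (j.cycleRange.symm t) := by
  rw [pairPerm, Equiv.Perm.mul_apply, Equiv.Perm.decomposeFin_symm_apply_succ, Equiv.swap_self]
  exact Fin.cycleRange_symm_succ _ _

theorem pairPerm_one {i j : Fin (n + 1)} (h : i ≤ j) : pairPerm i j 1 = j.succ := by
  rw [← Fin.succ_zero_eq_one, pairPerm_succ, Fin.cycleRange_symm_zero,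
    Fin.succAbove_of_le_castSucc _ _ (by simpa using h)]

theorem pairPerm_succ_succ (i j : Fin (n + 1)) (t : Fin n) :
    pairPerm i j t.succ.succ = i.castSucc.succAbove (j.succAbove t) := by
  rw [pairPerm_succ, Fin.cycleRange_symm_succ]

/-- The permutation is a product of two inverse cycles, of signs (-1)^i and (-1)^j. -/
theorem sign_pairPerm (i j : Fin (n + 1)) :
    Equiv.Perm.sign (pairPerm i j) = (-1) ^ ((i : ℕ) + (j : ℕ)) := by
  rw [pairPerm, map_mul, Equiv.Perm.sign_inv, Fin.sign_cycleRange,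
    Equiv.Perm.decomposeFin.symm_sign, if_pos rfl, one_mul, Equiv.Perm.sign_inv,
    Fin.sign_cycleRange, pow_add, Fin.val_castSucc]

theorem perm_eq_of_strictMono_succ_succ {σ τ : Equiv.Perm (Fin (n + 2))} (h0 : σ 0 = τ 0)
    (h1 : σ 1 = τ 1) (hσ : StrictMono fun t : Fin n => σ t.succ.succ)
    (hτ : StrictMono fun t : Fin n => τ t.succ.succ) : σ = τ := by
  -- The tail takes precisely the values not taken at 0 and 1, and a strictly increasing map is
  -- determined by its range.
  have hr : ∀ ρ : Equiv.Perm (Fin (n + 2)),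
      Set.range (fun t : Fin n => ρ t.succ.succ) = {ρ 0, ρ 1}ᶜ := by
    intro ρ
    ext y
    obtain ⟨a, rfl⟩ := ρ.surjective y
    simp only [Set.mem_range, EmbeddingLike.apply_eq_iff_eq, Set.mem_compl_iff,
      Set.mem_insert_iff, Set.mem_singleton_iff]
    refine Fin.cases ?_ (fun b => ?_) a
    · simp [Fin.succ_ne_zero]
    · refine Fin.cases ?_ (fun c => ?_) b
      · simp [Fin.ext_iff]
      · exact ⟨fun _ => by simp [Fin.ext_iff], fun _ => ⟨c, rfl⟩⟩
  have h2 := (StrictMono.range_inj hσ hτ).1 (by rw [hr, hr, h0, h1])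
  ext1 a
  refine Fin.cases h0 (fun b => ?_) a
  exact Fin.cases h1 (fun c => congrFun h2 c) b

theorem isUnshuffle_two_iff (σ : Equiv.Perm (Fin (n + 2))) :
    IsUnshuffle ![2, n + 2 - 2] σ ↔ σ 0 < σ 1 ∧ StrictMono fun t : Fin n => σ t.succ.succ := by
  have e0 : blockStart ![2, n + 2 - 2] 0 = 0 := by simp [blockStart]
  have e1 : blockStart ![2, n + 2 - 2] 1 = 2 := by
    have : Finset.univ.filter (fun s : Fin 2 => s < 1) = {0} := by decide
    rw [blockStart, this, Finset.sum_singleton]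
    rfl
  constructor
  · intro h
    refine ⟨h 0 0 1 ?_ ?_ ?_, fun s t hst => h 1 _ _ ?_ ?_ ?_⟩
    · rw [e0]; exact Nat.zero_le _
    · simp
    · rw [e0]; simp
    · rw [e1]; simp
    · simpa using hst
    · rw [e1]
      have := t.isLt
      simp
      omega
  · rintro ⟨h1, h2⟩ r a b ha hab hb
    fin_cases r
    · change blockStart ![2, n + 2 - 2] 0 ≤ _ at ha
      change _ < blockStart ![2, n + 2 - 2] 0 + 2 at hb
      rw [e0] at hb
      have ha0 : a = 0 := Fin.ext (by have : (a : ℕ) < b := hab; rw [Fin.val_zero]; omega)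
      have hb0 : b = 1 := Fin.ext (by have : (a : ℕ) < b := hab; rw [Fin.val_one]; omega)
      rw [ha0, hb0]
      exact h1
    · change blockStart ![2, n + 2 - 2] 1 ≤ _ at ha
      rw [e1] at ha
      have hab' : (a : ℕ) < b := hab
      obtain ⟨s, rfl⟩ : ∃ s : Fin n, a = s.succ.succ :=
        ⟨⟨a - 2, by omega⟩, by ext; simp; omega⟩
      obtain ⟨t, rfl⟩ : ∃ t : Fin n, b = t.succ.succ :=
        ⟨⟨b - 2, by omega⟩, by ext; simp; omega⟩
      exact h2 (by simpa using hab)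

/-- Matches the unshuffle sum to the indexing of the Chevalley–Eilenberg differential: such an
unshuffle is determined by its first two values i < j + 1. -/
theorem sum_unshuffles_two {W : Type*} [AddCommMonoid W] (g : Equiv.Perm (Fin (n + 2)) → W) :
    ∑ σ ∈ Finset.univ.filter (fun σ : Equiv.Perm (Fin (n + 2)) => IsUnshuffle ![2, n + 2 - 2] σ),
      g σ = ∑ i : Fin (n + 1), ∑ j ≥ i, g (pairPerm i j) := by
  rw [Finset.sum_sigma']
  symm
  refine Finset.sum_bij (fun ij _ => pairPerm ij.1 ij.2) ?_ ?_ ?_ (fun _ _ => rfl)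
  · rintro ⟨i, j⟩ hij
    simp only [Finset.mem_sigma, Finset.mem_univ, Finset.mem_Ici, true_and] at hij
    simp only [Finset.mem_filter, Finset.mem_univ, true_and, isUnshuffle_two_iff]
    refine ⟨?_, fun s t hst => ?_⟩
    · rw [pairPerm_zero, pairPerm_one hij]
      exact Fin.castSucc_lt_succ_iff.2 hij
    · change pairPerm i j s.succ.succ < pairPerm i j t.succ.succ
      rw [pairPerm_succ_succ, pairPerm_succ_succ]
      exact Fin.strictMono_succAbove _ (Fin.strictMono_succAbove _ hst)
  · rintro ⟨i, j⟩ hij ⟨i', j'⟩ hij' h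
    simp only [Finset.mem_sigma, Finset.mem_univ, Finset.mem_Ici, true_and] at hij hij'
    have h0 := congrArg (fun σ : Equiv.Perm (Fin (n + 2)) => σ 0) h
    have h1 := congrArg (fun σ : Equiv.Perm (Fin (n + 2)) => σ 1) h
    simp only [pairPerm_zero, pairPerm_one hij, pairPerm_one hij'] at h0 h1
    rw [Fin.castSucc_injective _ h0, Fin.succ_injective _ h1]
  · intro σ hσ
    simp only [Finset.mem_filter, Finset.mem_univ, true_and, isUnshuffle_two_iff] at hσ
    obtain ⟨hlt, hmono⟩ := hσ
    obtain ⟨i, hi⟩ := Fin.exists_castSucc_eq.2 (Fin.ne_last_of_lt hlt)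
    obtain ⟨j, hj⟩ := Fin.exists_succ_eq.2 (Fin.ne_zero_of_lt hlt)
    have hij : i ≤ j := by
      rw [← hi, ← hj] at hlt
      exact Fin.castSucc_lt_succ_iff.1 hlt
    refine ⟨⟨i, j⟩, by simpa using hij, perm_eq_of_strictMono_succ_succ ?_ ?_ ?_ hmono⟩
    · rw [pairPerm_zero, hi]
    · rw [pairPerm_one hij, hj]
    · intro s t hst
      change pairPerm i j s.succ.succ < pairPerm i j t.succ.succ
      rw [pairPerm_succ_succ, pairPerm_succ_succ]
      exact Fin.strictMono_succAbove _ (Fin.strictMono_succAbove _ hst)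

end Unshuffles

/-! ### The morphism equations out of a Lie algebra -/

section Morphisms

variable {𝔤 : Type*} [LieRing 𝔤] [LieAlgebra ℝ 𝔤] {W : Type*} [AddCommGroup W] [Module ℝ W]

theorem lieLInfty_br_two (x : Fin 2 → 𝔤) : (lieLInfty 𝔤).br 2 x = ⁅x 0, x 1⁆ := rfl

theorem lieLInfty_br_of_ne {i : ℕ} (hi : i ≠ 2) : (lieLInfty 𝔤).br i = 0 := by
  match i, hi with
  | 0, _ => rfl
  | 1, _ => rfl
  | 2, h => exact absurd rfl h
  | _ + 3, _ => rfl

theorem morphismLHS_lie_one (f : ∀ k : ℕ, MultilinearMap ℝ (fun _ : Fin k => 𝔤) W)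
    (d : Fin 1 → ℤ) (x : Fin 1 → 𝔤) : morphismLHS (lieLInfty 𝔤) f d x = 0 := by
  rw [morphismLHS]
  refine Finset.sum_eq_zero fun i hi => Finset.sum_eq_zero fun σ _ => ?_
  rw [lieLInfty_br_of_ne (by have := Finset.mem_Icc.1 hi; omega),
    MultilinearMap.map_coord_zero _ 0 rfl, smul_zero]

theorem morphismLHS_lie {n : ℕ} (f : ∀ k : ℕ, MultilinearMap ℝ (fun _ : Fin k => 𝔤) W)
    (d : Fin (n + 2) → ℤ) (x : Fin (n + 2) → 𝔤) : morphismLHS (lieLInfty 𝔤) f d x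
      = ∑ i : Fin (n + 1), ∑ j ≥ i, ((-1) ^ ((i : ℕ) + (j : ℕ)) * koszulSign (pairPerm i j) d) •
        f (n + 1) (Matrix.vecCons ⁅x i.castSucc, x j.succ⁆
          (j.removeNth (i.castSucc.removeNth x))) := by
  rw [morphismLHS, Finset.sum_eq_single 2, sum_unshuffles_two]
  · refine Finset.sum_congr rfl fun i _ => Finset.sum_congr rfl fun j hj => ?_
    have hij : i ≤ j := by simpa using hj
    -- The exponent i(j + 1) is even since i = 2.
    rw [Int.negOnePow_even _ (by simp), one_mul, sign_pairPerm]
    congr 1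
    change f (n + 1) (Matrix.vecCons _ _) = _
    congr 1
    refine congrArg₂ Matrix.vecCons ?_ ?_
    · rw [lieLInfty_br_two]
      change ⁅x (pairPerm i j 0), x (pairPerm i j 1)⁆ = _
      rw [pairPerm_zero, pairPerm_one hij]
    · funext t
      change dite _ _ _ = _
      have h : 2 + (t : ℕ) < n + 2 := by have := t.isLt; omega
      rw [dif_pos h]
      have h2 : (⟨2 + t, h⟩ : Fin (n + 2)) = Fin.succ (Fin.succ (t : Fin n)) := by
        ext; simp; omega
      change x (pairPerm i j ⟨2 + t, h⟩) = _
      rw [h2, pairPerm_succ_succ]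
      rfl
  · intro i _ hi
    refine Finset.sum_eq_zero fun σ _ => ?_
    rw [lieLInfty_br_of_ne hi, MultilinearMap.map_coord_zero _ 0 rfl, smul_zero]
  · intro h
    exact absurd (Finset.mem_Icc.2 ⟨by omega, by omega⟩) h

/-- For arguments of degree `0`, the left-hand side is a Chevalley–Eilenberg differential. -/
theorem morphismLHS_lie_zero {n : ℕ} (f : ∀ k : ℕ, 𝔤 [⋀^Fin k]→ₗ[ℝ] W) (x : Fin (n + 2) → 𝔤) :
    morphismLHS (lieLInfty 𝔤) (fun k => (f k).toMultilinearMap) 0 x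
      = -ceDiff (n + 1) (f (n + 1)) x := by
  rw [morphismLHS_lie, ceDiff_apply, neg_neg]
  refine Finset.sum_congr rfl fun i _ => Finset.sum_congr rfl fun j _ => ?_
  rw [koszulSign_zero, mul_one, Units.smul_def]
  simp

/-- Disposes of arguments of nonzero degree, which are zero in a Lie algebra; every argument occurs
in each summand, inside or outside the bracket. -/
theorem morphismLHS_lie_eq_zero {n : ℕ} (f : ∀ k : ℕ, MultilinearMap ℝ (fun _ : Fin k => 𝔤) W)
    (d : Fin (n + 2) → ℤ) (x : Fin (n + 2) → 𝔤) (a : Fin (n + 2)) (ha : x a = 0) :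
    morphismLHS (lieLInfty 𝔤) f d x = 0 := by
  rw [morphismLHS_lie]
  refine Finset.sum_eq_zero fun i _ => Finset.sum_eq_zero fun j hj => ?_
  have hij : i ≤ j := by simpa using hj
  obtain ⟨c, rfl⟩ := (pairPerm i j).surjective a
  have h : ∃ t, (Matrix.vecCons ⁅x i.castSucc, x j.succ⁆ (j.removeNth (i.castSucc.removeNth x)) :
      Fin (n + 1) → 𝔤) t = 0 := by
    refine Fin.cases (fun ha => ⟨0, ?_⟩) (fun c => Fin.cases (fun ha => ⟨0, ?_⟩)
      (fun c ha => ⟨c.succ, ?_⟩) c) c ha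
    · rw [pairPerm_zero] at ha
      rw [Matrix.cons_val_zero, ha, zero_lie]
    · rw [Fin.succ_zero_eq_one, pairPerm_one hij] at ha
      rw [Matrix.cons_val_zero, ha, lie_zero]
    · rw [pairPerm_succ_succ] at ha
      exact ha
  obtain ⟨t, ht⟩ := h
  rw [MultilinearMap.map_coord_zero _ t ht, smul_zero]

variable {V : Type*} [AddCommGroup V] [Module ℝ V]

theorem blockStart_one {p : ℕ} (r : Fin p) : blockStart (fun _ : Fin p => 1) r = r := by
  rw [blockStart, Finset.sum_const, smul_eq_mul, mul_one, Finset.filter_gt_eq_Iio, Fin.card_Iio]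

theorem blockStart_single (κ : Fin 1 → ℕ) (r : Fin 1) : blockStart κ r = 0 := by
  rw [blockStart, Finset.sum_eq_zero]
  intro s hs
  rw [Finset.mem_filter, Subsingleton.elim s r] at hs
  exact absurd hs.2 (lt_irrefl _)

/-- With unit blocks the sum of the p - r is again N(N-1)/2, so this number occurs twice. -/
theorem betaExponent_one_even {N : ℕ} : Even (betaExponent (fun _ : Fin N => 1) (0 : Fin N → ℤ)) := by
  have h1 : ∑ r : Fin N, ((1 : ℕ) : ℤ) * ((N : ℤ) - ((r : ℕ) + 1)) = ((N * (N - 1) / 2 : ℕ) : ℤ) := by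
    rw [← Finset.sum_range_id_mul_two, Nat.mul_div_cancel _ two_pos,
      ← Finset.sum_range_reflect, Nat.cast_sum, ← Fin.sum_univ_eq_sum_range
        (fun j => ((N - 1 - j : ℕ) : ℤ))]
    refine Finset.sum_congr rfl fun r _ => ?_
    have := r.isLt
    rw [Nat.cast_one, one_mul]
    omega
  rw [betaExponent, h1]
  simp

theorem betaExponent_single_even {N : ℕ} (κ : Fin 1 → ℕ) :
    Even (betaExponent κ (0 : Fin N → ℤ)) := by
  simp [betaExponent]

/-- If the brackets of arity at least `2` vanish as soon as one argument is a value of a component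
of arity at least `2`, then the right-hand side has only two terms. -/
theorem morphismRHS_eq {n : ℕ} (L : LInftyData W)
    (f : ∀ k : ℕ, MultilinearMap ℝ (fun _ : Fin k => V) W)
    (hL : ∀ p, 2 ≤ p → ∀ (y : Fin p → W) r k, 2 ≤ k → (∃ z, y r = f k z) → L.br p y = 0)
    (d : Fin (n + 2) → ℤ) (x : Fin (n + 2) → V) :
    ∃ u v : ℤˣ, (d = 0 → u = 1 ∧ v = 1) ∧ morphismRHS L f d x
      = u • L.br 1 (fun _ => f (n + 2) x) + v • L.br (n + 2) (fun r => f 1 (fun _ => x r)) := by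
  have hmono1 : ∀ (κ : Fin 1 → ℕ), κ 0 = n + 2 → ∀ σ : Equiv.Perm (Fin (n + 2)),
      IsUnshuffle κ σ → σ = 1 := by
    intro κ hκ σ h
    refine perm_eq_one_of_strictMono fun a b hab => h 0 a b ?_ hab ?_
    · rw [blockStart_single]; exact Nat.zero_le _
    · rw [blockStart_single, hκ, zero_add]; exact b.isLt
  -- All blocks have equal length one, so the ordering of blocks makes the permutation increasing.
  have hmono2 : ∀ σ : Equiv.Perm (Fin (n + 2)),
      IsBlockOrdered (fun _ : Fin (n + 2) => 1) σ → σ = 1 := by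
    intro σ h
    refine perm_eq_one_of_strictMono (Fin.strictMono_iff_lt_succ.2 fun i => ?_)
    refine h i.castSucc i.succ (by simp) rfl _ _ ?_ ?_ <;> rw [blockStart_one]
  have hun1 : ∀ κ : Fin 1 → ℕ, IsUnshuffle κ (1 : Equiv.Perm (Fin (n + 2))) ∧
      IsBlockOrdered κ (1 : Equiv.Perm (Fin (n + 2))) := by
    refine fun κ => ⟨fun r a b _ hab _ => hab, fun r s hs => ?_⟩
    rw [Subsingleton.elim s r] at hs
    omega
  have hun2 : IsUnshuffle (fun _ : Fin (n + 2) => 1) (1 : Equiv.Perm (Fin (n + 2))) ∧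
      IsBlockOrdered (fun _ : Fin (n + 2) => 1) (1 : Equiv.Perm (Fin (n + 2))) := by
    refine ⟨fun r a b _ hab _ => hab, fun r s hs _ a b ha hb => ?_⟩
    rw [blockStart_one] at ha hb
    change (a : ℕ) < b
    omega
  refine ⟨Int.negOnePow (betaExponent (fun _ : Fin 1 => n + 2) d) * koszulSign 1 d,
    Int.negOnePow (betaExponent (fun _ : Fin (n + 2) => 1) d) * koszulSign 1 d, ?_, ?_⟩
  · rintro rfl
    rw [koszulSign_zero, Int.negOnePow_even _ (betaExponent_single_even _),
      Int.negOnePow_even _ betaExponent_one_even]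
    exact ⟨rfl, rfl⟩
  rw [morphismRHS, Finset.sum_eq_add 1 (n + 2) (by omega)]
  · congr 1
    · rw [Finset.sum_eq_single (fun _ => n + 2)]
      · rw [Finset.sum_eq_single 1]
        · rw [Equiv.Perm.sign_one, mul_one]
          congr 2
          funext r
          refine congrArg (f (n + 2)) ?_
          funext t
          change dite _ _ _ = _
          have h : blockStart (fun _ : Fin 1 => n + 2) r + (t : ℕ) < n + 2 := by
            rw [blockStart_single, zero_add]; exact t.isLt
          rw [dif_pos h]
          refine congrArg x (Fin.ext ?_)
          change blockStart (fun _ : Fin 1 => n + 2) r + (t : ℕ) = t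
          rw [blockStart_single, zero_add]
        · intro σ hσ hne
          exact absurd (hmono1 _ rfl σ (Finset.mem_filter.1 hσ).2.1) hne
        · intro h
          refine absurd ?_ h
          rw [Finset.mem_filter]
          exact ⟨Finset.mem_univ _, hun1 _⟩
      · intro κ hκ hne
        refine absurd ?_ hne
        rw [Finset.mem_filter, Finset.Nat.mem_antidiagonalTuple, Fin.sum_univ_one] at hκ
        funext r
        rw [Subsingleton.elim r 0, hκ.1]
      · intro h
        refine absurd (Finset.mem_filter.2 ⟨?_, fun _ => Nat.le_add_left 1 (n + 1), fun _ _ _ => le_rfl⟩) h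
        rw [Finset.Nat.mem_antidiagonalTuple, Fin.sum_univ_one]
    · rw [Finset.sum_eq_single (fun _ => 1)]
      · rw [Finset.sum_eq_single 1]
        · rw [Equiv.Perm.sign_one, mul_one]
          congr 2
          funext r
          refine congrArg (f 1) ?_
          funext t
          change dite _ _ _ = _
          have ht : blockStart (fun _ : Fin (n + 2) => 1) r + (t : ℕ) = r := by
            rw [blockStart_one, Nat.lt_one_iff.1 t.isLt, add_zero]
          have h : blockStart (fun _ : Fin (n + 2) => 1) r + (t : ℕ) < n + 2 := by
            rw [ht]; exact r.isLt
          rw [dif_pos h]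
          exact congrArg x (Fin.ext ht)
        · intro σ hσ hne
          exact absurd (hmono2 σ (Finset.mem_filter.1 hσ).2.2) hne
        · intro h
          refine absurd ?_ h
          rw [Finset.mem_filter]
          exact ⟨Finset.mem_univ _, hun2⟩
      · intro κ hκ hne
        obtain ⟨r, hr⟩ := Function.ne_iff.1 hne
        have h1 := (Finset.mem_filter.1 hκ).2.1 r
        refine Finset.sum_eq_zero fun σ _ => ?_
        rw [hL (n + 2) (by omega) _ r (κ r) (by omega) ⟨_, rfl⟩, smul_zero]
      · intro h
        refine absurd (Finset.mem_filter.2 ⟨?_, fun _ => le_rfl, fun _ _ _ => le_rfl⟩) h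
        rw [Finset.Nat.mem_antidiagonalTuple]
        simp
  · rintro p hp ⟨hp1, hpN⟩
    rw [Finset.mem_Icc] at hp
    refine Finset.sum_eq_zero fun κ hκ => Finset.sum_eq_zero fun σ _ => ?_
    rw [Finset.mem_filter, Finset.Nat.mem_antidiagonalTuple] at hκ
    -- If every block had length one, there would be N = n + 2 of them.
    have hr : ∃ r, κ r ≠ 1 := by
      by_contra h
      push Not at h
      have h2 := hκ.1
      simp only [h, Finset.sum_const, Finset.card_univ, Fintype.card_fin, smul_eq_mul,
        mul_one] at h2
      exact hpN h2
    obtain ⟨r, hr⟩ := hr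
    have h1 := hκ.2.1 r
    rw [hL p (by omega) _ r (κ r) (by omega) ⟨_, rfl⟩, smul_zero]
  · intro h
    exact absurd (Finset.mem_Icc.2 ⟨le_rfl, by omega⟩) h
  · intro h
    exact absurd (Finset.mem_Icc.2 ⟨by omega, le_rfl⟩) h

theorem morphismRHS_eq_zero {n : ℕ} (L : LInftyData W)
    (f : ∀ k : ℕ, MultilinearMap ℝ (fun _ : Fin k => V) W)
    (hL : ∀ p, 2 ≤ p → ∀ (y : Fin p → W) r k, 2 ≤ k → (∃ z, y r = f k z) → L.br p y = 0)
    (d : Fin (n + 2) → ℤ) (x : Fin (n + 2) → V) (i : Fin (n + 2)) (hi : x i = 0) :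
    morphismRHS L f d x = 0 := by
  obtain ⟨u, v, -, h⟩ := morphismRHS_eq L f hL d x
  rw [h, MultilinearMap.map_coord_zero (L.br 1) 0 (MultilinearMap.map_coord_zero _ i hi),
    MultilinearMap.map_coord_zero (L.br (n + 2)) i (MultilinearMap.map_coord_zero _ 0 hi),
    smul_zero, smul_zero, add_zero]

theorem map_comp_perm_of_coord_zero {k : ℕ} (f : MultilinearMap ℝ (fun _ : Fin k => V) W)
    (x : Fin k → V) (i : Fin k) (hi : x i = 0) (σ : Equiv.Perm (Fin k)) (u : ℤˣ) :
    f (x ∘ σ) = u • f x := by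
  rw [MultilinearMap.map_coord_zero f i hi, smul_zero,
    MultilinearMap.map_coord_zero f (σ.symm i) (by simpa using hi)]

/-- The equation in arity one only concerns l_1 on values of f_1; these lie in L_0, where l_1 is
zero. -/
theorem morphismRHS_one_eq_zero (L : LInftyData W)
    (f : ∀ k : ℕ, MultilinearMap ℝ (fun _ : Fin k => V) W)
    (hL : ∀ y z, (∀ r, y r = f 1 z) → L.br 1 y = 0)
    (d : Fin 1 → ℤ) (x : Fin 1 → V) : morphismRHS L f d x = 0 := by
  rw [morphismRHS]
  refine Finset.sum_eq_zero fun p hp => Finset.sum_eq_zero fun κ hκ =>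
    Finset.sum_eq_zero fun σ _ => ?_
  obtain rfl : p = 1 := by have := Finset.mem_Icc.1 hp; omega
  rw [Finset.mem_filter, Finset.Nat.mem_antidiagonalTuple, Fin.sum_univ_one] at hκ
  obtain rfl : κ = fun _ => 1 := by
    funext r
    rw [Subsingleton.elim r 0, hκ.1]
  rw [hL _ _ fun r => by rw [Subsingleton.elim r 0], smul_zero]

end Morphisms

/-! ### Assembling the homotopy co-moment map -/

section ComomentMap

variable {E : Type*} [NormedAddCommGroup E] [NormedSpace ℝ E] [FiniteDimensional ℝ E]
  {M : Type*} [TopologicalSpace M] [ChartedSpace E M] [IsManifold 𝓘(ℝ, E) ∞ M]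
  {𝔤 : Type*} [LieRing 𝔤] [LieAlgebra ℝ 𝔤] {m : ℕ} {ω₀ : DiffForm E M (m + 2)}

/-- Brackets of arity at least two factor through the L_0-components, so a single argument without
one annihilates them. -/
theorem observables_br_eq_zero (hω : extD E M (m + 2) ω₀ = 0) (p : ℕ) (hp : 2 ≤ p)
    (y : Fin p → ObsSpace ω₀) (r : Fin p) (hr : (y r).1 = 0) :
    (observables ω₀ hω).br p y = 0 := by
  match p, hp with
  | 2, _ =>
    change (l2Top ω₀ hω (y 0).1 (y 1).1, (0 : ∀ q : Fin m, DiffForm E M q)) = 0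
    have h : l2Top ω₀ hω (y 0).1 (y 1).1 = 0 := by
      fin_cases r
      · have hr' : (y 0).1 = 0 := hr
        rw [hr', (l2Top ω₀ hω).map_zero]
        rfl
      · have hr' : (y 1).1 = 0 := hr
        rw [hr']
        exact (l2Top ω₀ hω (y 0).1).map_zero
    rw [h]
    rfl
  | k + 3, _ =>
    change ((0 : hamiltonianPairs ω₀), fun q : Fin m => lkForm ω₀ (k + 3) q y) = 0
    have h : (fun q : Fin m => lkForm ω₀ (k + 3) q y) = 0 := by
      funext q
      have hv : obsVec ω₀ (y r) = 0 := by
        change (y r).1.1.1 = 0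
        rw [hr]
        rfl
      rw [lkForm]
      split_ifs with h
      · change (-(-1 : ℝ) ^ ((k + 3) * (k + 3 + 1) / 2)) •
          (iterContract E M q (k + 3) (fun i => obsVec ω₀ (y i)) (h ▸ ω₀)) = 0
        rw [MultilinearMap.map_coord_zero _ r hv, LinearMap.zero_apply]
        exact smul_zero (M := ℝ) (A := DiffForm E M q) _
      · rfl
    rw [h]
    rfl

/-- The sign -(-1)^(k(k+1)/2) of the bracket and the sign (-1)^(k(k-1)/2) of reversal combine to
-(-1)^k; this is the source of the sign in `obstruction`. -/
theorem lkForm_apply (ζ : 𝔤 →ₗ⁅ℝ⁆ VecField E M) (k q : ℕ) (y : Fin k → ObsSpace ω₀)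
    (x : Fin k → 𝔤) (hy : ∀ i, obsVec ω₀ (y i) = ζ (x i)) :
    lkForm ω₀ k q y = (-(-1 : ℝ) ^ k) • actionCochain ζ ω₀ k x q := by
  rw [lkForm]
  split_ifs with h
  · change (-(-1 : ℝ) ^ (k * (k + 1) / 2)) •
      (iterContract E M q k (fun i => obsVec ω₀ (y i)) (h ▸ ω₀)) = _
    have hy' : (fun i => obsVec ω₀ (y i)) = fun i => ζ (x i) := funext hy
    rw [hy', iterContract_eq ζ ω₀ q k h x, smul_smul, neg_mul, ← pow_add]
    congr 2
    have h1 : k * (k + 1) / 2 = k * (k - 1) / 2 + k := by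
      have h3 := Nat.triangle_succ k
      rw [← h3, Nat.mul_comm]
      rfl
    rw [h1, show k * (k - 1) / 2 + k + k * (k - 1) / 2 = 2 * (k * (k - 1) / 2) + k by ring,
      pow_add, pow_mul, neg_one_sq, one_pow, one_mul]
  · rw [actionCochain_eq_zero ζ ω₀ k x q (fun h' => h h'.symm)]
    exact (smul_zero (M := ℝ) (A := DiffForm E M q) _).symm

theorem l1Form_apply (η : TotalForm E M) (q : Fin m) :
    l1Form q (fun q : Fin m => η q) = totalD E M η q := by
  obtain ⟨q, hq⟩ := q
  cases q <;> rfl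

theorem l1Top_apply (η : TotalForm E M) :
    (l1Top ω₀ (fun q : Fin m => η q)).1 = ((0 : VecField E M), totalD E M η m) := by
  cases m <;> rfl

variable (F : ∀ k, 𝔤 [⋀^Fin k]→ₗ[ℝ] TotalForm E M) (ζ : 𝔤 →ₗ⁅ℝ⁆ VecField E M)
  (hF : ∀ k x, totalD E M (F (k + 1) x) = actionObstruction ζ ω₀ k (F k) x)

/-- The form component of arity one. -/
def unaryForm : 𝔤 →ₗ[ℝ] DiffForm E M m :=
  LinearMap.proj (R := ℝ) (φ := fun q => DiffForm E M q) m ∘ₗ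
    (AlternatingMap.ofSubsingleton ℝ 𝔤 (TotalForm E M) (0 : Fin 1)).symm (F 1)

include hF in
theorem extD_unaryForm (X : 𝔤) :
    extD E M m (unaryForm F X) = -contract E M (m + 1) (ζ X) ω₀ := by
  have h := congrFun (hF 0 (fun _ => X)) (m + 1)
  rw [totalD_succ, actionObstruction_zero_apply] at h
  exact h

/-- The component of arity one. -/
def unaryComponent : 𝔤 →ₗ[ℝ] ObsSpace ω₀ :=
  LinearMap.inl ℝ (hamiltonianPairs ω₀) (∀ q : Fin m, DiffForm E M q) ∘ₗ
    LinearMap.codRestrict (hamiltonianPairs ω₀)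
      (LinearMap.prod (ζ : 𝔤 →ₗ[ℝ] VecField E M) (unaryForm F)) (extD_unaryForm F ζ hF)

/-- The projection of a family of forms to the components of negative degree of `L(M, ω)`. -/
def negPart (ω₀ : DiffForm E M (m + 2)) : TotalForm E M →ₗ[ℝ] ObsSpace ω₀ :=
  LinearMap.inr ℝ (hamiltonianPairs ω₀) (∀ q : Fin m, DiffForm E M q) ∘ₗ
    -- Degrees q ≥ m are dropped; nothing is lost in arity k ≥ 2, where the only degree is m + 1 - k
    -- < m.
    LinearMap.pi fun q => LinearMap.proj (R := ℝ) (φ := fun q => DiffForm E M q) (q : ℕ)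

/-- The components of a homotopy co-moment map. -/
def comomentComponent : ∀ k : ℕ, 𝔤 [⋀^Fin k]→ₗ[ℝ] ObsSpace ω₀
  | 1 => AlternatingMap.ofSubsingleton ℝ 𝔤 (ObsSpace ω₀) (0 : Fin 1) (unaryComponent F ζ hF)
  | k => (negPart ω₀).compAlternatingMap (F k)

theorem comomentComponent_add_two (k : ℕ) : comomentComponent F ζ hF (k + 2)
    = (negPart ω₀).compAlternatingMap (F (k + 2)) := rfl

theorem comomentComponent_fst {k : ℕ} (hk : 2 ≤ k) (x : Fin k → 𝔤) :
    (comomentComponent F ζ hF k x).1 = 0 := by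
  obtain ⟨k, rfl⟩ := Nat.exists_eq_add_of_le' hk
  rfl

theorem comomentComponent_mem_obsDeg (hdeg : ∀ k x q, q + k ≠ m + 1 → F k x q = 0) (k : ℕ)
    (hk : 1 ≤ k) (x : Fin k → 𝔤) : comomentComponent F ζ hF k x ∈ obsDeg ω₀ (1 - k) := by
  match k, hk with
  | 1, _ => exact ⟨fun h => absurd (by simp) h, fun q _ => rfl⟩
  | k + 2, _ =>
    refine ⟨fun _ => rfl, fun q hq => hdeg (k + 2) x q fun h => hq ?_⟩
    push_cast
    omega

theorem ceDiff_one_apply {W : Type*} [AddCommGroup W] [Module ℝ W] (c : 𝔤 [⋀^Fin 1]→ₗ[ℝ] W)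
    (x : Fin 2 → 𝔤) : -ceDiff 1 c x = c (fun _ => ⁅x 0, x 1⁆) := by
  have h := congrArg (fun g => g (fun _ : Fin 1 => x 1)) (curryLeft_ceDiff_one (x 0) c)
  have h2 := congrArg (fun g => g (fun _ : Fin 0 => (0 : 𝔤))) (curryLeft_ceLie 0 (x 0) (x 1) c)
  have e1 : Matrix.vecCons (x 0) (fun _ : Fin 1 => x 1) = x := by
    funext i; fin_cases i <;> rfl
  have e2 : ∀ X : 𝔤, Matrix.vecCons X (fun _ : Fin 0 => (0 : 𝔤)) = fun _ => X := by
    intro X; funext i; rw [Subsingleton.elim i 0]; rfl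
  change ceDiff 1 c (Matrix.vecCons (x 0) (fun _ : Fin 1 => x 1)) = _ at h
  change ceLie 1 (x 0) c (Matrix.vecCons (x 1) (fun _ : Fin 0 => (0 : 𝔤)))
    = 0 - c (Matrix.vecCons ⁅x 0, x 1⁆ (fun _ : Fin 0 => (0 : 𝔤))) at h2
  rw [e2, e2] at h2
  rw [e1, h2] at h
  rw [h, zero_sub, neg_neg]

theorem contract_contract_eq (v : Fin 2 → 𝔤) :
    contract E M m (ζ (v 1)) (contract E M (m + 1) (ζ (v 0)) ω₀)
      = -actionCochain ζ ω₀ 2 v m := by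
  have h := iterContract_eq ζ ω₀ m 2 rfl v
  rw [show (-1 : ℝ) ^ (2 * (2 - 1) / 2) = -1 by norm_num] at h
  refine Eq.trans ?_ (h.trans (neg_one_smul ℝ (actionCochain ζ ω₀ 2 v m)))
  rfl

/-- Arity two is the only one whose equation lives in L_0. The vector field part says that ζ
preserves brackets; the form part is the tower equation, since l_2 contributes minus the contraction
cochain. -/
theorem comoment_equation_two (hω : extD E M (m + 2) ω₀ = 0)
    (hdeg : ∀ k x q, q + k ≠ m + 1 → F k x q = 0) (x : Fin 2 → 𝔤) :
    -ceDiff 1 (comomentComponent F ζ hF 1) x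
      = (observables ω₀ hω).br 1 (fun _ => comomentComponent F ζ hF 2 x)
        + (observables ω₀ hω).br 2 (fun r => comomentComponent F ζ hF 1 (fun _ => x r)) := by
  rw [ceDiff_one_apply]
  have hD := hF 1 x
  change unaryComponent F ζ hF ⁅x 0, x 1⁆ = (l1Top ω₀ (fun q : Fin m => F 2 x q)
      + l2Top ω₀ hω (unaryComponent F ζ hF (x 0)).1 (unaryComponent F ζ hF (x 1)).1,
    (fun q : Fin m => l1Form q (fun q : Fin m => F 2 x q)) + 0)
  refine Prod.ext (Subtype.ext (Prod.ext ?_ ?_)) ?_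
  · have h := congrArg Prod.fst (l1Top_apply (ω₀ := ω₀) (F 2 x))
    change ζ ⁅x 0, x 1⁆ = (l1Top ω₀ (fun q : Fin m => F 2 x q)).1.1 + ⁅ζ (x 0), ζ (x 1)⁆
    rw [h, LieHom.map_lie]
    exact (zero_add _).symm
  · have h := congrArg Prod.snd (l1Top_apply (ω₀ := ω₀) (F 2 x))
    change F 1 (fun _ => ⁅x 0, x 1⁆) m = (l1Top ω₀ (fun q : Fin m => F 2 x q)).1.2
      + contract E M m (ζ (x 1)) (contract E M (m + 1) (ζ (x 0)) ω₀)
    rw [h, contract_contract_eq, hD, actionObstruction_apply, ceDiff_one_apply]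
    change F 1 (fun _ => ⁅x 0, x 1⁆) m = F 1 (fun _ => ⁅x 0, x 1⁆) m
      + (-1 : ℝ) ^ (1 + 1) • actionCochain ζ ω₀ 2 x m + -actionCochain ζ ω₀ 2 x m
    module
  · funext q
    change (0 : DiffForm E M q) = l1Form q (fun q : Fin m => F 2 x q) + 0
    -- The differential of `F 2` is concentrated in degree m, so the lower degrees contribute
    -- nothing.
    rw [add_zero]
    rw [l1Form_apply, hD]
    exact (actionObstruction_eq_zero ζ ω₀ 1 (F 1) (hdeg 1) x q (by have := q.isLt; omega)).symm

theorem comoment_equation_add_three (hω : extD E M (m + 2) ω₀ = 0)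
    (hdeg : ∀ k x q, q + k ≠ m + 1 → F k x q = 0) (n : ℕ) (x : Fin (n + 3) → 𝔤) :
    -ceDiff (n + 2) (comomentComponent F ζ hF (n + 2)) x
      = (observables ω₀ hω).br 1 (fun _ => comomentComponent F ζ hF (n + 3) x)
        + (observables ω₀ hω).br (n + 3) (fun r => comomentComponent F ζ hF 1 (fun _ => x r)) := by
  have hD := hF (n + 2) x
  rw [comomentComponent_add_two, ← compAlternatingMap_ceDiff]
  change -(negPart ω₀ (ceDiff (n + 2) (F (n + 2)) x)) = (l1Top ω₀ (fun q : Fin m => F (n + 3) x q)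
      + (0 : hamiltonianPairs ω₀),
    (fun q : Fin m => l1Form q (fun q : Fin m => F (n + 3) x q)) +
      fun q : Fin m => lkForm ω₀ (n + 3) q (fun r => comomentComponent F ζ hF 1 (fun _ => x r)))
  refine Prod.ext ?_ ?_
  -- The obstruction is concentrated in the degree q with q + (n + 2) = m + 1, which is never m.
  · have h : l1Top ω₀ (fun q : Fin m => F (n + 3) x q) = 0 := by
      refine Subtype.ext ?_
      rw [l1Top_apply, hD, actionObstruction_eq_zero ζ ω₀ (n + 2) _ (hdeg (n + 2)) x m (by omega)]
      rfl
    change -(0 : hamiltonianPairs ω₀) = l1Top ω₀ (fun q : Fin m => F (n + 3) x q) + 0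
    rw [h]
    exact (neg_zero (G := hamiltonianPairs ω₀)).trans (add_zero (M := hamiltonianPairs ω₀) 0).symm
  · funext q
    change -(ceDiff (n + 2) (F (n + 2)) x q) = l1Form q (fun q : Fin m => F (n + 3) x q)
      + lkForm ω₀ (n + 3) q (fun r => comomentComponent F ζ hF 1 (fun _ => x r))
    rw [l1Form_apply, lkForm_apply ζ (n + 3) q _ x (fun _ => rfl), hD, actionObstruction_apply]
    change -(ceDiff (n + 2) (F (n + 2)) x q) = -(ceDiff (n + 2) (F (n + 2)) x q)
      + (-1 : ℝ) ^ (n + 3) • actionCochain ζ ω₀ (n + 3) x q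
      + (-(-1 : ℝ) ^ (n + 3)) • actionCochain ζ ω₀ (n + 3) x q
    module

theorem comoment_equation (hω : extD E M (m + 2) ω₀ = 0)
    (hdeg : ∀ k x q, q + k ≠ m + 1 → F k x q = 0) (n : ℕ) (x : Fin (n + 2) → 𝔤) :
    -ceDiff (n + 1) (comomentComponent F ζ hF (n + 1)) x
      = (observables ω₀ hω).br 1 (fun _ => comomentComponent F ζ hF (n + 2) x)
        + (observables ω₀ hω).br (n + 2) (fun r => comomentComponent F ζ hF 1 (fun _ => x r)) := by
  cases n with
  | zero => exact comoment_equation_two F ζ hF hω hdeg x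
  | succ n => exact comoment_equation_add_three F ζ hF hω hdeg n x

theorem mem_lieLInfty_deg {x : 𝔤} {i : ℤ} (hx : x ∈ (lieLInfty 𝔤).deg i) (hi : i ≠ 0) : x = 0 := by
  change x ∈ (if i = 0 then ⊤ else ⊥ : Submodule ℝ 𝔤) at hx
  rw [if_neg hi] at hx
  exact hx

/-- Splits every morphism axiom in two: all degrees zero, where the Koszul signs are trivial, or a
vanishing argument, where both sides are zero. -/
theorem degrees_eq_zero_or {N : ℕ} {d : Fin N → ℤ} {x : Fin N → 𝔤}
    (hx : ∀ i, x i ∈ (lieLInfty 𝔤).deg (d i)) : d = 0 ∨ ∃ i, x i = 0 := by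
  by_cases h : d = 0
  · exact Or.inl h
  · obtain ⟨i, hi⟩ := Function.ne_iff.1 h
    exact Or.inr ⟨i, mem_lieLInfty_deg (hx i) hi⟩

theorem comoment_map_br (hω : extD E M (m + 2) ω₀ = 0)
    (hdeg : ∀ k x q, q + k ≠ m + 1 → F k x q = 0) (n : ℕ) (d : Fin (n + 2) → ℤ)
    (x : Fin (n + 2) → 𝔤) (hx : ∀ i, x i ∈ (lieLInfty 𝔤).deg (d i)) :
    morphismLHS (lieLInfty 𝔤) (fun k => (comomentComponent F ζ hF k).toMultilinearMap) d x
      = morphismRHS (observables ω₀ hω)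
        (fun k => (comomentComponent F ζ hF k).toMultilinearMap) d x := by
  have hL : ∀ p, 2 ≤ p → ∀ (y : Fin p → ObsSpace ω₀) r k, 2 ≤ k →
      (∃ z, y r = (comomentComponent F ζ hF k).toMultilinearMap z) →
      (observables ω₀ hω).br p y = 0 := fun p hp y r k hk ⟨z, hz⟩ =>
    observables_br_eq_zero hω p hp y r (by
      rw [hz]
      exact comomentComponent_fst F ζ hF hk z)
  rcases degrees_eq_zero_or hx with rfl | ⟨i, hi⟩
  · obtain ⟨u, v, huv, hR⟩ := morphismRHS_eq (observables ω₀ hω)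
      (fun k => (comomentComponent F ζ hF k).toMultilinearMap) hL 0 x
    obtain ⟨rfl, rfl⟩ := huv rfl
    rw [hR, morphismLHS_lie_zero, one_smul, one_smul]
    exact comoment_equation F ζ hF hω hdeg n x
  · rw [morphismLHS_lie_eq_zero _ d x i hi]
    exact (morphismRHS_eq_zero (observables ω₀ hω)
      (fun k => (comomentComponent F ζ hF k).toMultilinearMap) hL d x i hi).symm

theorem comoment_map_br_one (hω : extD E M (m + 2) ω₀ = 0) (d : Fin 1 → ℤ) (x : Fin 1 → 𝔤) :
    morphismLHS (lieLInfty 𝔤) (fun k => (comomentComponent F ζ hF k).toMultilinearMap) d x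
      = morphismRHS (observables ω₀ hω)
        (fun k => (comomentComponent F ζ hF k).toMultilinearMap) d x := by
  rw [morphismLHS_lie_one, morphismRHS_one_eq_zero]
  intro y z hy
  change obsL1 ω₀ (y 0) = 0
  rw [hy 0]
  exact map_zero (LinearMap.prod (l1Top ω₀) (LinearMap.pi l1Form))

/-- The homotopy co-moment map with given components. -/
def comomentMap (hω : extD E M (m + 2) ω₀ = 0) (hdeg : ∀ k x q, q + k ≠ m + 1 → F k x q = 0) :
    LInftyMorphism (lieLInfty 𝔤) (observables ω₀ hω) where
  f k := (comomentComponent F ζ hF k).toMultilinearMap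
  map_degree k hk d x hx := by
    rcases degrees_eq_zero_or hx with rfl | ⟨i, hi⟩
    · simp only [Pi.zero_apply, Finset.sum_const_zero, add_zero]
      exact comomentComponent_mem_obsDeg F ζ hF hdeg k hk x
    · have h : (comomentComponent F ζ hF k).toMultilinearMap x = 0 :=
        MultilinearMap.map_coord_zero _ i hi
      rw [h]
      exact zero_mem _
  map_perm k _ d x hx σ := by
    rcases degrees_eq_zero_or hx with rfl | ⟨i, hi⟩
    · rw [koszulSign_zero, mul_one]
      exact AlternatingMap.map_perm (N' := ObsSpace ω₀) (comomentComponent F ζ hF k) x σ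
    · exact map_comp_perm_of_coord_zero (W := ObsSpace ω₀) (comomentComponent F ζ hF k).toMultilinearMap x i hi σ _
  map_br N hN d x hx := by
    match N, hN with
    | 1, _ => exact comoment_map_br_one F ζ hF hω d x
    | n + 2, _ => exact comoment_map_br F ζ hF hω hdeg n d x hx

theorem isHomotopyComomentMap_comomentMap (hω : extD E M (m + 2) ω₀ = 0)
    (hdeg : ∀ k x q, q + k ≠ m + 1 → F k x q = 0) :
    IsHomotopyComomentMap (comomentMap F ζ hF hω hdeg) ζ := fun _ => rfl

end ComomentMap

end NPlectic

end

theorem mainTheorem6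
    {E : Type*} [NormedAddCommGroup E] [NormedSpace ℝ E] [FiniteDimensional ℝ E]
    {M : Type*} [TopologicalSpace M] [ChartedSpace E M] [IsManifold 𝓘(ℝ, E) ∞ M]
    [ConnectedSpace M]
    {𝔤 : Type*} [LieRing 𝔤] [LieAlgebra ℝ 𝔤] [FiniteDimensional ℝ 𝔤]
    (m : ℕ) (ω₀ : NPlectic.DiffForm E M (m + 2)) (hω : NPlectic.extD E M (m + 2) ω₀ = 0)
    (ζ : 𝔤 →ₗ⁅ℝ⁆ NPlectic.VecField E M) (hζ : NPlectic.IsWeaklyHamiltonian ω₀ ζ)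
    (hH : ∀ k : ℕ, 1 ≤ k → k ≤ m → Subsingleton (NPlectic.DeRhamCohomology E M k))
    (p : M) (hc : ∃ b : 𝔤 [⋀^Fin (m + 1)]→ₗ[ℝ] ℝ,
      NPlectic.ceD 𝔤 (m + 1) b = NPlectic.momentCochain ω₀ ζ p) :
    ∃ F : NPlectic.LInftyMorphism (NPlectic.lieLInfty 𝔤) (NPlectic.observables ω₀ hω),
      NPlectic.IsHomotopyComomentMap F ζ := by
  obtain ⟨b, hb⟩ := hc
  obtain ⟨F, hdeg, hF⟩ := NPlectic.exists_components hω hζ hH p b hb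
  exact ⟨NPlectic.comomentMap F ζ hF hω hdeg,
    NPlectic.isHomotopyComomentMap_comomentMap F ζ hF hω hdeg⟩
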